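/- **Setting.** Let $\mathcal A$ be a finite set of candidates, $k:\mathcal A\times\mathcal A\to\mathbb R$ a (symmetric) positive semidefinite kernel, $\lambda\ge 1$. For a finite dictionary $\mathcal S\subseteq\mathcal A$ with kernel matrix $K_{\mathcal S}$ and $k_{\mathcal S}(x)=(k(x',x))_{x'\in\mathcal S}$, let $z(x,\mathcal S)=K_{\mathcal S}^{+/2}k_{\mathcal S}(x)$, where $(\cdot)^{+/2}$ is the square root of the pseudo-inverse. For candidates $x_1,\dots,x_t$ and feedback $y_1,\dots,y_t$, let $Z_t$ be the matrix with rows $z(x_1,\mathcal S)^{\mathsf T},\dots,z(x_t,\mathcal S)^{\mathsf T}$, let $V_t=Z_t^{\mathsf T}Z_t+\lambda I$, and $$\tilde\mu_t(x,\mathcal S)=z(x,\mathcal S)^{\mathsf T}V_t^{-1}Z_t^{\mathsf T}(y_1,\dots,y_t)^{\mathsf T},\qquad \tilde\sigma_t^2(x,\mathcal S)=\tfrac1\lambda\big(k(x,x)-z(x,\mathcal S)^{\mathsf T}z(x,\mathcal S)\big)+z(x,\mathcal S)^{\mathsf T}V_t^{-1}z(x,\mathcal S).$$ The exact posterior variance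 is $\sigma_t^2(x)=\tilde\sigma_t^2(x,\mathcal A)$. **Algorithm (BBKB).** The parameters are $T\in\mathbb N$, a threshold $\tilde C\ge1$, a fixed exponent $r\in\{1,2\}$, numbers $\bar q_t\ge 1$ ($t\ge0$), and real widths $\tilde\alpha_t$ which may depend on the past. The feedback at step $t$ is $y_t=f(x_t)+\eta_t$ with $f:\mathcal A\to\mathbb R$ arbitrary and $\eta_t$ i.i.d. $\mathcal N(0,\xi^2)$, where $\eta_t$ is independent of everything that happened before step $t$ and of the choice of $x_t$. Start with $\mathrm{fb}(0)=0$, $\mathcal S_0=\emptyset$ and a first candidate $x_1$ with an arbitrary law (for instance uniform). For $t=0,\dots,T-1$: 1. if $t\ge1$, select $x_{t+1}\in\arg\max_{x\in\mathcal A}\ \tilde\mu_{\mathrm{fb}(t)}(x,\mathcal S_{\mathrm{fb}(t)})+\tilde\alpha_{\mathrm{fb}(t)}\tilde\sigma_t(x,\mathcal S_{\mathrm{fb}(t)})$, ties being broken by any rule that depends only on the past; 2. if $1+\sum_{s=\mathrm{fb}(t)+1}^{t+1}\tilde\sigma_{\mathrm{fb}(t)}(x_s,\mathcal S_{\mathrm{fb}(t)})^r\le\tilde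 C$, set $\mathrm{fb}(t+1)=\mathrm{fb}(t)$ (the dictionary is kept); 3. otherwise set $\mathrm{fb}(t+1)=t+1$, and, given the past (which includes $x_1,\dots,x_{t+1}$), draw independent Bernoulli variables $z_{t+1,s}$, $1\le s\le t+1$, with parameters $\min\{1,\ \bar q_t\,\tilde\sigma^2_{\mathrm{fb}(t)}(x_s,\mathcal S_{\mathrm{fb}(t)})\}$; the new dictionary is $\mathcal S_{t+1}=\{x_s: z_{t+1,s}=1\}$. **Lemma.** Let $\delta\in(0,1)$, $\tilde C\ge1$, $\lambda\ge1$, and run BBKB with $\bar q_t\ge 8\log(4t/\delta)$ for all $t\ge1$ (and $\bar q_0\ge1$). Then, with probability at least $1-\delta$, for all $t\in\{0,\dots,T\}$ and all $x\in\mathcal A$, $$\frac{\sigma_{\mathrm{fb}(t)}^2(x)}{3}\ \le\ \tilde\sigma_{\mathrm{fb}(t)}^2(x,\mathcal S_{\mathrm{fb}(t)})\ \le\ 3\,\sigma_{\mathrm{fb}(t)}^2(x).$$ -/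

import Mathlib

open MeasureTheory ProbabilityTheory

noncomputable section

namespace BBKB

variable {A : Type*}

/-- The kernel matrix of the points of a dictionary `S`. -/
def gram (k : Matrix A A ℝ) (S : Finset A) : Matrix S S ℝ :=
  Matrix.of fun i j => k i j

/-- The square root of the Moore–Penrose pseudo-inverse of a positive semidefinite matrix `M`:
the eigenvalue `v > 0` is sent to `1 / √v` and the eigenvalue `0` to `0`. -/
def pinvSqrt {n : Type*} [Fintype n] [DecidableEq n] (M : Matrix n n ℝ) : Matrix n n ℝ :=
  cfc (fun v : ℝ => (Real.sqrt v)⁻¹) M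

variable [DecidableEq A]

/-- The Nyström embedding `z(a, S) = K_S^{+/2} k_S(a)`. -/
def embed (k : Matrix A A ℝ) (S : Finset A) (a : A) : S → ℝ :=
  (pinvSqrt (gram k S)).mulVec fun i => k i a

/-- The embedded design matrix `Z(X_t, S)`, whose rows are `z(x_1, S), …, z(x_t, S)`.
Sequences of candidates are indexed from `1`. -/
def embedMat (k : Matrix A A ℝ) (S : Finset A) (x : ℕ → A) (t : ℕ) : Matrix (Fin t) S ℝ :=
  Matrix.of fun i => embed k S (x (i + 1))

/-- `V_t = Z(X_t, S)ᵀ Z(X_t, S) + λ I`. -/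
def designMat (k : Matrix A A ℝ) (lam : ℝ) (S : Finset A) (x : ℕ → A) (t : ℕ) : Matrix S S ℝ :=
  (embedMat k S x t).transpose * embedMat k S x t + lam • (1 : Matrix S S ℝ)

/-- The approximate posterior mean `z(a, S)ᵀ V_t⁻¹ Z(X_t, S)ᵀ y_t`. -/
def approxMean (k : Matrix A A ℝ) (lam : ℝ) (S : Finset A) (x : ℕ → A) (y : ℕ → ℝ) (t : ℕ)
    (a : A) : ℝ :=
  embed k S a ⬝ᵥ (designMat k lam S x t)⁻¹.mulVec
    ((embedMat k S x t).transpose.mulVec fun i : Fin t => y (i + 1))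

/-- The approximate posterior variance
`(k(a, a) - z(a, S)ᵀ z(a, S)) / λ + z(a, S)ᵀ V_t⁻¹ z(a, S)`. -/
def approxVar (k : Matrix A A ℝ) (lam : ℝ) (S : Finset A) (x : ℕ → A) (t : ℕ) (a : A) : ℝ :=
  (1 / lam) * (k a a - embed k S a ⬝ᵥ embed k S a)
    + embed k S a ⬝ᵥ (designMat k lam S x t)⁻¹.mulVec (embed k S a)

/-- The approximate posterior standard deviation. -/
def approxStd (k : Matrix A A ℝ) (lam : ℝ) (S : Finset A) (x : ℕ → A) (t : ℕ) (a : A) : ℝ :=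
  Real.sqrt (approxVar k lam S x t a)

/-- The exact posterior variance: the one computed with the perfect dictionary, which contains
all the candidates. -/
def exactVar [Fintype A] (k : Matrix A A ℝ) (lam : ℝ) (x : ℕ → A) (t : ℕ) (a : A) : ℝ :=
  approxVar k lam Finset.univ x t a

/-- The batched upper confidence bound: the mean uses the feedback up to the last step `b` of the
previous batch, and the standard deviation uses all the candidates selected up to step `t`. -/
def ucb (k : Matrix A A ℝ) (lam : ℝ) (S : Finset A) (x : ℕ → A) (y : ℕ → ℝ) (α : ℝ) (b t : ℕ)
    (a : A) : ℝ :=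
  approxMean k lam S x y b a + α * approxStd k lam S x t a

/-- The condition under which the current batch, which began after step `b`, is continued with
the candidate `x_{t+1}`. -/
def Continue (k : Matrix A A ℝ) (lam C : ℝ) (r : ℕ) (S : Finset A) (x : ℕ → A) (b t : ℕ) :
    Prop :=
  1 + ∑ s ∈ Finset.Icc (b + 1) (t + 1), approxStd k lam S x b (x s) ^ r ≤ C

/-- The probability with which `x_s` enters the new dictionary when the old dictionary is `S` and
the last batch began after step `b` (a Bernoulli parameter, hence capped at `1`). -/
def inclProb (k : Matrix A A ℝ) (lam q : ℝ) (S : Finset A) (x : ℕ → A) (b s : ℕ) : ℝ :=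
  min 1 (q * approxVar k lam S x b (x s))

/-- A run of the batched algorithm over `T` steps, on a probability space `(Ω, P)`.

* `x t` is the candidate selected at step `t`, for `1 ≤ t ≤ T`;
* `η t` is the noise of the feedback `f (x t) + η t` at step `t`;
* `α t` is the (possibly data-dependent) width of the confidence bounds;
* `fb t` is the last step of the previous batch;
* `S t` is the dictionary in use after step `t`, that is, the one drawn at step `fb t`;
* `z t s` is the Bernoulli variable that decides whether `x s` enters the dictionary drawn at
  step `t`;
* `ℱ t` is the information available once `x (t + 1)` is selected, before any draw of step
  `t + 1`. The first candidate `x 1` may have any law (the uniform one, for example). -/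
structure IsRun {Ω : Type*} [mΩ : MeasurableSpace Ω] (P : Measure Ω)
    (k : Matrix A A ℝ) (lam C : ℝ) (r : ℕ) (q : ℕ → ℝ) (f : A → ℝ) (ξsq : NNReal) (T : ℕ)
    (ℱ : Filtration ℕ mΩ) (x : ℕ → Ω → A) (η : ℕ → Ω → ℝ) (α : ℕ → Ω → ℝ)
    (fb : ℕ → Ω → ℕ) (S : ℕ → Ω → Finset A) (z : ℕ → ℕ → Ω → Bool) : Prop where
  /-- The next candidate is chosen from the past. -/
  x_adapted : ∀ t < T, ∀ a, MeasurableSet[ℱ t] {ω | x (t + 1) ω = a}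
  /-- The confidence widths are chosen from the past. -/
  α_adapted : ∀ t < T, Measurable[ℱ t] (α t)
  η_adapted : ∀ t < T, Measurable[ℱ (t + 1)] (η (t + 1))
  z_adapted : ∀ t < T, ∀ s, Measurable[ℱ (t + 1)] (z (t + 1) s)
  /-- The noise is centred Gaussian with variance `ξsq` … -/
  η_law : ∀ t < T, P.map (η (t + 1)) = gaussianReal 0 ξsq
  /-- … and independent of the past; in particular the noise variables are i.i.d. -/
  η_indep : ∀ t < T, Indep (MeasurableSpace.comap (η (t + 1)) inferInstance) (ℱ t) P
  fb_zero : ∀ ω, fb 0 ω = 0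
  S_zero : ∀ ω, S 0 ω = ∅
  /-- After the first step, the next candidate maximizes the upper confidence bound; ties may be
  broken in any way that only depends on the past. -/
  x_argmax : ∀ t, 1 ≤ t → t < T → ∀ ω a,
    ucb k lam (S t ω) (fun s => x s ω) (fun s => f (x s ω) + η s ω) (α (fb t ω) ω) (fb t ω) t a
      ≤ ucb k lam (S t ω) (fun s => x s ω) (fun s => f (x s ω) + η s ω) (α (fb t ω) ω) (fb t ω) t
          (x (t + 1) ω)
  /-- Batch construction step: the dictionary is kept. -/
  batch_step : ∀ t < T, ∀ ω, Continue k lam C r (S t ω) (fun s => x s ω) (fb t ω) t →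
    fb (t + 1) ω = fb t ω ∧ S (t + 1) ω = S t ω
  /-- Resparsification step: a new dictionary is made of the points whose draw is `1`. -/
  resparsify_step : ∀ t < T, ∀ ω, ¬ Continue k lam C r (S t ω) (fun s => x s ω) (fb t ω) t →
    fb (t + 1) ω = t + 1 ∧
      S (t + 1) ω =
        ((Finset.Icc 1 (t + 1)).filter fun s => z (t + 1) s ω = true).image fun s => x s ω
  /-- At a resparsification step the draws are, given the past, independent Bernoulli variables
  with the inclusion probabilities as parameters. -/
  z_law : ∀ t < T, ∀ B ⊆ Finset.Icc 1 (t + 1), ∀ᵐ ω ∂P,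
    ¬ Continue k lam C r (S t ω) (fun s => x s ω) (fb t ω) t →
      condExp (ℱ t) P
          (Set.indicator
            {ω' | ((Finset.Icc 1 (t + 1)).filter fun s => z (t + 1) s ω' = true) = B}
            fun _ => (1 : ℝ)) ω
        = ∏ s ∈ Finset.Icc 1 (t + 1),
            if s ∈ B then inclProb k lam (q t) (S t ω) (fun u => x u ω) (fb t ω) s
            else 1 - inclProb k lam (q t) (S t ω) (fun u => x u ω) (fb t ω) s

end BBKB

end

/-! Write `k = Rᵀ * R`, so that each candidate has a feature vector φ. If Q projects onto the span
of the features of the dictionary and Φ is the design matrix of features, the approximate variance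
is φᵀ(QΦᵀΦQ + λ)⁻¹φ (`exists_proj_approxVar`), and Q acts as the identity on features for the full
dictionary. Hence only the residual matters: if the energy ∑⟨φ(x_s), v⟩² is at most (4/3)λ|v|² for
every v orthogonal to the dictionary, the two covariances, and so the variances, agree up to a
factor 3 in the required directions (`approxVar_accurate`).

A resparsification fails only if some v orthogonal to all retained features has large energy. After
whitening by the old covariance this is bounded by a one-sided matrix Chernoff estimate, n·exp(-L)
(`sum_missed_le_card`). Its proof reveals the draws one by one and follows tr (1 + Y/N)^N, a
polynomial stand-in for tr exp Y: a rejected vector x adds xxᵀ to Y, and a retained one compresses Y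
to the complement of x. The expected trace does not increase (`trace_step_le`).

The inclusion probabilities come from the old dictionary, so its residual level c' enters the
exponent for the new level c (`sum_not_residualLE_le`). With the single level 4/3 the failure bound
is of order t·t^(-42/25), which is not summable. A sharper level 3/5 is therefore tracked too. From
a sharp dictionary, failure is summable; moderate dictionaries are rarely entered, and a
resparsification keeps one moderate with probability at most 1/2. The potential P(Failed) +
weight·P(Moderate) grows by at most δ·`increment t` per step (`potential_succ_le`), and the
increments sum to at most 1. -/

namespace BBKB

/-! ### Moment inequalities for positive operators, from the spectral measure at a vector. -/

section Moments

variable {E : Type*} [NormedAddCommGroup E] [InnerProductSpace ℝ E] [FiniteDimensional ℝ E]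

/-- Moments of the spectral measure of `T` at `e`. -/
theorem exists_spectral_moments {T : E →ₗ[ℝ] E} (hT : T.IsPositive) (e : E) :
    ∃ (w l : Fin (Module.finrank ℝ E) → ℝ), (∀ k, 0 ≤ w k) ∧ (∀ k, 0 ≤ l k) ∧
      ∀ (a t : ℝ) (i j : ℕ),
        inner ℝ e (((a • 1 + T) ^ i * (t • 1 + T) ^ j) e)
          = ∑ k, w k * ((a + l k) ^ i * (t + l k) ^ j) := by
  set b := hT.isSymmetric.eigenvectorBasis rfl with hb
  set l := hT.isSymmetric.eigenvalues rfl with hl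
  refine ⟨fun k => inner ℝ e (b k) ^ 2, l, fun k => sq_nonneg _, hT.nonneg_eigenvalues rfl, ?_⟩
  have hTb : ∀ k, T (b k) = l k • b k := hT.isSymmetric.apply_eigenvectorBasis rfl
  have hpow : ∀ (s : ℝ) (m : ℕ) (k), ((s • 1 + T) ^ m) (b k) = (s + l k) ^ m • b k := by
    intro s m k
    induction m with
    | zero => simp
    | succ m ih =>
      rw [pow_succ', Module.End.mul_apply, ih, map_smul, LinearMap.add_apply,
        LinearMap.smul_apply, Module.End.one_apply, hTb, ← add_smul, smul_smul, pow_succ]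
  intro a t i j
  have he : e = ∑ k, inner ℝ (b k) e • b k := (b.sum_repr' e).symm
  calc inner ℝ e (((a • 1 + T) ^ i * (t • 1 + T) ^ j) e)
      = inner ℝ e (((a • 1 + T) ^ i * (t • 1 + T) ^ j) (∑ k, inner ℝ (b k) e • b k)) := by
        rw [← he]
    _ = _ := by
        rw [map_sum, inner_sum]
        refine Finset.sum_congr rfl fun k _ => ?_
        rw [map_smul, Module.End.mul_apply, hpow, map_smul, hpow, inner_smul_right,
          inner_smul_right, inner_smul_right, real_inner_comm e (b k)]
        ring

/-- Chebyshev's association inequality for a weighted sum. -/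
theorem weighted_chebyshev {ι : Type*} [Fintype ι] (w f g : ι → ℝ) (hw : ∀ k, 0 ≤ w k)
    (h : ∀ k l, 0 ≤ (f k - f l) * (g k - g l)) :
    (∑ k, w k * f k) * (∑ k, w k * g k) ≤ (∑ k, w k) * ∑ k, w k * (f k * g k) := by
  have h0 : 0 ≤ ∑ k, ∑ l, w k * w l * ((f k - f l) * (g k - g l)) :=
    Finset.sum_nonneg fun k _ => Finset.sum_nonneg fun l _ =>
      mul_nonneg (mul_nonneg (hw k) (hw l)) (h k l)
  have h1 : ∑ k, ∑ l, w k * w l * ((f k - f l) * (g k - g l))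
      = 2 * ((∑ k, w k) * ∑ k, w k * (f k * g k)
        - (∑ k, w k * f k) * (∑ k, w k * g k)) := by
    have e1 : ∀ k l, w k * w l * ((f k - f l) * (g k - g l))
        = w l * (w k * (f k * g k)) + w k * (w l * (f l * g l))
          - w k * f k * (w l * g l) - w l * f l * (w k * g k) := fun k l => by ring
    simp only [e1, Finset.sum_sub_distrib, Finset.sum_add_distrib, ← Finset.mul_sum,
      ← Finset.sum_mul]
    ring
  linarith

theorem mul_sub_pow_nonneg {x y a t : ℝ} (hx : 0 ≤ a + x) (hy : 0 ≤ a + y) (hx' : 0 ≤ t + x)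
    (hy' : 0 ≤ t + y) (i j : ℕ) :
    0 ≤ ((a + x) ^ i - (a + y) ^ i) * ((t + x) ^ j - (t + y) ^ j) := by
  rcases le_total x y with h | h
  · have h1 : (a + x) ^ i ≤ (a + y) ^ i := by gcongr
    have h2 : (t + x) ^ j ≤ (t + y) ^ j := by gcongr
    nlinarith
  · have h1 : (a + y) ^ i ≤ (a + x) ^ i := by gcongr
    have h2 : (t + y) ^ j ≤ (t + x) ^ j := by gcongr
    nlinarith

/-- Both powers are nondecreasing functions of the same spectral variable, hence positively
correlated under the spectral measure at `e`, which has mass 1. -/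
theorem inner_pow_mul_inner_pow_le {T : E →ₗ[ℝ] E} (hT : T.IsPositive) {e : E} (he : ‖e‖ = 1)
    {t : ℝ} (ht : 0 ≤ t) (i j : ℕ) :
    inner ℝ e ((T ^ i) e) * inner ℝ e (((t • 1 + T) ^ j) e)
      ≤ inner ℝ e ((T ^ i * (t • 1 + T) ^ j) e) := by
  obtain ⟨w, l, hw, hl, h⟩ := exists_spectral_moments hT e
  have h0 := h 0 0 0 0
  have h1 := h 0 0 i 0
  have h2 := h 0 t 0 j
  have h3 := h 0 t i j
  simp only [zero_smul, zero_add, pow_zero, mul_one, one_mul, Module.End.one_apply] at h0 h1 h2 h3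
  rw [real_inner_self_eq_norm_sq, he, one_pow] at h0
  rw [h1, h2, h3]
  have := weighted_chebyshev w (fun k => l k ^ i) (fun k => (t + l k) ^ j) hw fun k m => by
    simpa using mul_sub_pow_nonneg (a := 0) (x := l k) (y := l m) (t := t) (by simpa using hl k)
      (by simpa using hl m) (add_nonneg ht (hl k)) (add_nonneg ht (hl m)) i j
  rwa [← h0, one_mul] at this

theorem inner_pow_nonneg {T : E →ₗ[ℝ] E} (hT : T.IsPositive) (e : E) (i : ℕ) :
    0 ≤ inner ℝ e ((T ^ i) e) := by
  obtain ⟨w, l, hw, hl, h⟩ := exists_spectral_moments hT e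
  have h1 := h 0 0 i 0
  simp only [zero_smul, zero_add, pow_zero, mul_one] at h1
  rw [h1]
  exact Finset.sum_nonneg fun k _ => mul_nonneg (hw k) (pow_nonneg (hl k) _)

/-- Jensen's inequality for the powers of a positive operator. -/
theorem inner_pow_le_inner_pow {T : E →ₗ[ℝ] E} (hT : T.IsPositive) {e : E} (he : ‖e‖ = 1)
    (i : ℕ) : inner ℝ e (T e) ^ i ≤ inner ℝ e ((T ^ i) e) := by
  have h0 : 0 ≤ inner ℝ e (T e) := by simpa using inner_pow_nonneg hT e 1
  induction i with
  | zero => simp [he]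
  | succ i ih =>
    have := inner_pow_mul_inner_pow_le hT he le_rfl i 1
    simp only [zero_smul, zero_add, pow_one] at this
    rw [pow_succ, pow_succ]
    exact (mul_le_mul_of_nonneg_right ih h0).trans this

/-- A shift of `1 + Y` by `t` increases the moments by a factor of at most `(1 + t) ^ i`. -/
theorem inner_shift_pow_le {Y : E →ₗ[ℝ] E} (hY : Y.IsPositive) (e : E) {t : ℝ} (ht : 0 ≤ t)
    (i : ℕ) :
    inner ℝ e (((t • 1 + (1 + Y)) ^ i) e) ≤ (1 + t) ^ i * inner ℝ e (((1 + Y) ^ i) e) := by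
  obtain ⟨w, l, hw, hl, h⟩ := exists_spectral_moments hY e
  have h1 := h (t + 1) 0 i 0
  have h2 := h 1 0 i 0
  simp only [zero_smul, zero_add, pow_zero, mul_one, one_smul, add_smul, add_assoc] at h1 h2
  rw [h1, h2, Finset.mul_sum]
  refine Finset.sum_le_sum fun k _ => ?_
  have : (t + (1 + l k)) ^ i ≤ ((1 + t) * (1 + l k)) ^ i := by
    have := hl k
    gcongr
    nlinarith [mul_nonneg ht this]
  rw [mul_pow] at this
  calc _ ≤ w k * ((1 + t) ^ i * (1 + l k) ^ i) := mul_le_mul_of_nonneg_left this (hw k)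
    _ = _ := by ring

end Moments

/-! ### Rank-one perturbations and the trace of a power. -/

section RankOne

variable {E : Type*} [NormedAddCommGroup E] [InnerProductSpace ℝ E]

/-- The rank-one operator `v ↦ ⟪x, v⟫ x`. -/
noncomputable def outer (x : E) : E →ₗ[ℝ] E :=
  (InnerProductSpace.rankOne ℝ x x : E →L[ℝ] E)

@[simp]
theorem outer_apply (x v : E) : outer x v = inner ℝ x v • x := by
  simp [outer]

theorem outer_isPositive (x : E) : (outer x).IsPositive := by
  refine ⟨fun v w => ?_, fun v => ?_⟩
  · simp only [outer_apply, inner_smul_left, inner_smul_right, real_inner_comm]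
    simp [mul_comm]
  · simp only [outer_apply, inner_smul_left, RCLike.re_to_real]
    exact mul_self_nonneg _

theorem isPositive_smul {T : E →ₗ[ℝ] E} (hT : T.IsPositive) {c : ℝ} (hc : 0 ≤ c) :
    (c • T).IsPositive := by
  refine ⟨fun v w => ?_, fun v => ?_⟩
  · simp only [LinearMap.smul_apply, inner_smul_left, inner_smul_right, hT.1 v w]
    simp
  · have := hT.2 v
    simp only [LinearMap.smul_apply, inner_smul_left, RCLike.re_to_real] at this ⊢
    exact mul_nonneg hc this

variable [FiniteDimensional ℝ E]

theorem trace_mul_outer (S : E →ₗ[ℝ] E) (x : E) :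
    LinearMap.trace ℝ E (S * outer x) = inner ℝ x (S x) := by
  have : S * outer x = ((InnerProductSpace.rankOne ℝ (S x) x : E →L[ℝ] E) : E →ₗ[ℝ] E) := by
    ext v
    simp
  rw [this, InnerProductSpace.trace_rankOne]

theorem pow_sub_pow_eq_sum {R : Type*} [Ring R] (X T : R) (n : ℕ) :
    X ^ n - T ^ n = ∑ j ∈ Finset.range n, X ^ j * (X - T) * T ^ (n - 1 - j) := by
  induction n with
  | zero => simp
  | succ n ih =>
    rw [Finset.sum_range_succ]
    have : ∑ j ∈ Finset.range n, X ^ j * (X - T) * T ^ (n + 1 - 1 - j)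
        = (X ^ n - T ^ n) * T := by
      rw [ih, Finset.sum_mul]
      refine Finset.sum_congr rfl fun j hj => ?_
      have : n + 1 - 1 - j = (n - 1 - j) + 1 := by
        have := Finset.mem_range.1 hj
        omega
      rw [this, pow_succ, mul_assoc]
      simp only [mul_assoc]
    rw [this]
    simp only [add_tsub_cancel_right, tsub_self, pow_zero, mul_one, pow_succ, mul_sub, sub_mul]
    abel

/-- Peeling off one factor at a time, the rank-one term splits the expression into a product of two
moments, whereas the scalar shift keeps a joint moment; the correlation inequality compares them.
The exponent `i` varies in the induction because each peeling moves a factor `T` to the left. -/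
theorem inner_rankOne_perturb_le {T : E →ₗ[ℝ] E} (hT : T.IsPositive) {e : E} (he : ‖e‖ = 1)
    {t : ℝ} (ht : 0 ≤ t) (j : ℕ) : ∀ i : ℕ,
    inner ℝ e ((T ^ i * (T + t • outer e) ^ j) e) ≤ inner ℝ e ((T ^ i * (t • 1 + T) ^ j) e) := by
  induction j with
  | zero => intro i; simp
  | succ j ih =>
    intro i
    have h1 : inner ℝ e ((T ^ i * (T + t • outer e) ^ (j + 1)) e)
        = inner ℝ e ((T ^ (i + 1) * (T + t • outer e) ^ j) e)
          + t * (inner ℝ e ((T ^ i) e) * inner ℝ e (((T + t • outer e) ^ j) e)) := by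
      rw [pow_succ' (T + t • outer e), pow_succ T]
      simp only [Module.End.mul_apply, LinearMap.add_apply, LinearMap.smul_apply, outer_apply,
        map_add, map_smul, inner_add_right, inner_smul_right]
      ring
    have h2 : inner ℝ e ((T ^ i * (t • 1 + T) ^ (j + 1)) e)
        = inner ℝ e ((T ^ (i + 1) * (t • 1 + T) ^ j) e)
          + t * inner ℝ e ((T ^ i * (t • 1 + T) ^ j) e) := by
      rw [pow_succ' (t • 1 + T), pow_succ T]
      simp only [Module.End.mul_apply, LinearMap.add_apply, LinearMap.smul_apply,
        Module.End.one_apply, map_add, map_smul, inner_add_right, inner_smul_right]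
      ring
    rw [h1, h2]
    have h3 := ih (i + 1)
    have h4 := ih 0
    simp only [pow_zero, one_mul] at h4
    have h5 := inner_pow_mul_inner_pow_le hT he ht i j
    have h6 := mul_le_mul_of_nonneg_left h4 (inner_pow_nonneg hT e i)
    have h7 := mul_le_mul_of_nonneg_left (h6.trans h5) ht
    linarith

/-- A rank-one trace inequality of Golden–Thompson type. -/
theorem trace_rankOne_perturb_le {T : E →ₗ[ℝ] E} (hT : T.IsPositive) {e : E} (he : ‖e‖ = 1)
    {t : ℝ} (ht : 0 ≤ t) (n : ℕ) :
    LinearMap.trace ℝ E ((T + t • outer e) ^ n)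
      ≤ LinearMap.trace ℝ E (T ^ n)
        + (inner ℝ e (((t • 1 + T) ^ n) e) - inner ℝ e ((T ^ n) e)) := by
  -- The same telescoping is used for `T + t • outer e` under the trace and for `t • 1 + T` at `e`;
  -- the comparison is then term by term.
  have h1 := congrArg (LinearMap.trace ℝ E) (pow_sub_pow_eq_sum (T + t • outer e) T n)
  have h2 := congrArg (fun S : E →ₗ[ℝ] E => inner ℝ e (S e)) (pow_sub_pow_eq_sum (t • 1 + T) T n)
  simp only [map_sub, map_sum, LinearMap.sub_apply, inner_sub_right, LinearMap.sum_apply,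
    inner_sum] at h1 h2
  rw [h2, ← sub_le_iff_le_add', h1]
  refine Finset.sum_le_sum fun j _ => ?_
  have hc : Commute (t • (1 : E →ₗ[ℝ] E) + T) T :=
    ((Commute.one_left T).smul_left t).add_left (Commute.refl T)
  have e1 : LinearMap.trace ℝ E ((T + t • outer e) ^ j * (T + t • outer e - T) * T ^ (n - 1 - j))
      = t * inner ℝ e ((T ^ (n - 1 - j) * (T + t • outer e) ^ j) e) := by
    rw [add_sub_cancel_left, LinearMap.trace_mul_comm, ← mul_assoc, mul_smul_comm, map_smul,
      trace_mul_outer, smul_eq_mul]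
  have e2 : inner ℝ e (((t • 1 + T) ^ j * (t • 1 + T - T) * T ^ (n - 1 - j)) e)
      = t * inner ℝ e ((T ^ (n - 1 - j) * (t • 1 + T) ^ j) e) := by
    rw [add_sub_cancel_right, mul_smul_comm, mul_one, smul_mul_assoc, LinearMap.smul_apply,
      inner_smul_right, (hc.pow_pow j (n - 1 - j)).eq]
  rw [e1, e2]
  exact mul_le_mul_of_nonneg_left (inner_rankOne_perturb_le hT he ht j _) ht

end RankOne

/-! ### Compression to the orthogonal complement of a vector. -/

section Compression

variable {E : Type*} [NormedAddCommGroup E] [InnerProductSpace ℝ E] [FiniteDimensional ℝ E]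

/-- The compression of an operator to a subspace. -/
noncomputable def compress (K : Submodule ℝ E) (T : E →ₗ[ℝ] E) : K →ₗ[ℝ] K :=
  (K.orthogonalProjectionOnto : E →ₗ[ℝ] K) ∘ₗ T ∘ₗ K.subtype

theorem inner_compress (K : Submodule ℝ E) (T : E →ₗ[ℝ] E) (u v : K) :
    inner ℝ u (compress K T v) = inner ℝ (u : E) (T v) := by
  simp [compress]

theorem compress_isPositive (K : Submodule ℝ E) {T : E →ₗ[ℝ] E} (hT : T.IsPositive) :
    (compress K T).IsPositive := by
  refine ⟨fun u v => ?_, fun u => ?_⟩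
  · rw [real_inner_comm, inner_compress, inner_compress, ← hT.1, real_inner_comm]
  · rw [real_inner_comm, inner_compress, real_inner_comm]
    exact hT.2 u

theorem compress_one_add (K : Submodule ℝ E) (T : E →ₗ[ℝ] E) :
    compress K (1 + T) = 1 + compress K T := by
  ext v
  simp [compress]

theorem compress_smul (K : Submodule ℝ E) (c : ℝ) (T : E →ₗ[ℝ] E) :
    compress K (c • T) = c • compress K T := by
  ext v
  simp [compress]

theorem trace_eq_inner_add_trace_compress (S : E →ₗ[ℝ] E) {e : E} (he : ‖e‖ = 1) :
    LinearMap.trace ℝ E S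
      = inner ℝ e (S e) + LinearMap.trace ℝ _ (compress (ℝ ∙ e)ᗮ S) := by
  have h1 : LinearMap.trace ℝ _ (compress (ℝ ∙ e)ᗮ S)
      = LinearMap.trace ℝ E (S * (1 - outer e)) := by
    unfold compress
    rw [LinearMap.trace_comp_comm', LinearMap.comp_assoc]
    congr 2
    ext v
    have : (((ℝ ∙ e)ᗮ.orthogonalProjectionOnto v : (ℝ ∙ e)ᗮ) : E)
        = v - inner ℝ e v • e := by
      have := Submodule.starProjection_orthogonal_val (K := ℝ ∙ e) v
      rw [Submodule.starProjection_apply] at this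
      rw [this, Submodule.starProjection_unit_singleton ℝ he]
    simp [this]
  rw [h1, mul_sub, map_sub, trace_mul_outer]
  simp

theorem inner_pow_le_trace {T : E →ₗ[ℝ] E} (hT : T.IsPositive) {e : E} (he : ‖e‖ = 1) (n : ℕ) :
    inner ℝ e (T e) ^ n ≤ LinearMap.trace ℝ E (T ^ n) := by
  rw [trace_eq_inner_add_trace_compress _ he]
  have : 0 ≤ LinearMap.trace ℝ _ (compress (ℝ ∙ e)ᗮ (T ^ n)) := by
    rw [LinearMap.trace_eq_sum_inner _ (stdOrthonormalBasis ℝ _)]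
    refine Finset.sum_nonneg fun i _ => ?_
    rw [inner_compress]
    exact inner_pow_nonneg hT _ _
  linarith [inner_pow_le_inner_pow hT he n]

/-- The right side is the trace of the compression of `T ^ n`. In an eigenbasis of the compressed
operator the claim is Jensen's inequality for each eigenvector, taken back in the whole space. -/
theorem trace_compress_pow_le {T : E →ₗ[ℝ] E} (hT : T.IsPositive) {e : E} (he : ‖e‖ = 1)
    (n : ℕ) :
    LinearMap.trace ℝ _ (compress (ℝ ∙ e)ᗮ T ^ n)
      ≤ LinearMap.trace ℝ E (T ^ n) - inner ℝ e ((T ^ n) e) := by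
  rw [trace_eq_inner_add_trace_compress (T ^ n) he, add_sub_cancel_left]
  have hc := compress_isPositive (ℝ ∙ e)ᗮ hT
  set b := hc.isSymmetric.eigenvectorBasis rfl with hb
  rw [LinearMap.trace_eq_sum_inner _ b, LinearMap.trace_eq_sum_inner _ b]
  refine Finset.sum_le_sum fun i _ => ?_
  have hb1 : ‖b i‖ = 1 := b.orthonormal.1 i
  have hb2 : ‖((b i : (ℝ ∙ e)ᗮ) : E)‖ = 1 := hb1
  have hTb : compress (ℝ ∙ e)ᗮ T (b i) = hc.isSymmetric.eigenvalues rfl i • b i :=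
    hc.isSymmetric.apply_eigenvectorBasis rfl i
  have hpow : (compress (ℝ ∙ e)ᗮ T ^ n) (b i) = hc.isSymmetric.eigenvalues rfl i ^ n • b i := by
    induction n with
    | zero => simp
    | succ m ih => rw [pow_succ', Module.End.mul_apply, ih, map_smul, hTb, smul_smul, pow_succ]
  have hval : hc.isSymmetric.eigenvalues rfl i = inner ℝ ((b i : (ℝ ∙ e)ᗮ) : E) (T (b i)) := by
    rw [← inner_compress, hTb, inner_smul_right, real_inner_self_eq_norm_sq, hb1]
    simp
  rw [hpow, inner_smul_right, real_inner_self_eq_norm_sq, hb1, hval, inner_compress]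
  simpa using inner_pow_le_inner_pow hT hb2 n

end Compression

/-! ### A matrix Chernoff bound for directions missed by a random subset. -/

section Chernoff

universe u

theorem one_sub_mul_pow_le_one {p u : ℝ} (hu : 0 ≤ u) (hup : u ≤ p) {N : ℕ}
    (hN : 0 < N) : (1 - p) * (1 + u / N) ^ N ≤ 1 := by
  have hN' : (0 : ℝ) < N := Nat.cast_pos.2 hN
  have h1 : (1 + u / N) ^ N ≤ Real.exp u := by
    calc (1 + u / N) ^ N ≤ Real.exp (u / N) ^ N := by
          gcongr
          linarith [Real.add_one_le_exp (u / N)]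
      _ = Real.exp u := by
          rw [← Real.exp_nat_mul]
          congr 1
          field_simp
  have h2 : 1 - p ≤ Real.exp (-u) := by linarith [Real.add_one_le_exp (-u)]
  calc (1 - p) * (1 + u / N) ^ N ≤ Real.exp (-u) * Real.exp u := by
        gcongr
    _ = 1 := by rw [← Real.exp_add]; simp

section

variable {E : Type u} [NormedAddCommGroup E] [InnerProductSpace ℝ E]

theorem one_add_smul_isPositive {Y : E →ₗ[ℝ] E} (hY : Y.IsPositive) {c : ℝ} (hc : 0 ≤ c) :
    (1 + c • Y).IsPositive :=
  LinearMap.isPositive_one.add (isPositive_smul hY hc)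

variable [FiniteDimensional ℝ E]

/-- One step of the potential argument: with probability `1 - p` the operator grows by the
rank-one operator of `x`, and with probability `p` it is compressed to the complement of `x`. -/
theorem trace_step_le {Y : E →ₗ[ℝ] E} (hY : Y.IsPositive) {x : E} (hx : x ≠ 0) {p : ℝ}
    (hp0 : 0 ≤ p) (hp1 : p ≤ 1) (hxp : ‖x‖ ^ 2 ≤ p ∨ p = 1) {N : ℕ} (hN : 0 < N) :
    (1 - p) * LinearMap.trace ℝ E ((1 + (1 / N : ℝ) • (Y + outer x)) ^ N)
      + p * LinearMap.trace ℝ _ ((1 + (1 / N : ℝ) • compress (ℝ ∙ x)ᗮ Y) ^ N)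
      ≤ LinearMap.trace ℝ E ((1 + (1 / N : ℝ) • Y) ^ N) := by
  have hN' : (0 : ℝ) < N := Nat.cast_pos.2 hN
  have hx' : 0 < ‖x‖ := norm_pos_iff.2 hx
  set e : E := (‖x‖)⁻¹ • x with he_def
  have he : ‖e‖ = 1 := by
    rw [he_def, norm_smul, norm_inv, norm_norm, inv_mul_cancel₀ hx'.ne']
  have hspan : (ℝ ∙ x) = (ℝ ∙ e) :=
    (Submodule.span_singleton_smul_eq (IsUnit.mk0 _ (inv_ne_zero hx'.ne')) x).symm
  have hT := one_add_smul_isPositive hY (c := 1 / N) (by positivity)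
  set T : E →ₗ[ℝ] E := 1 + (1 / N : ℝ) • Y with hTdef
  have hT0 : 0 ≤ inner ℝ e ((T ^ N) e) := inner_pow_nonneg hT e N
  have h1 : LinearMap.trace ℝ E ((1 + (1 / N : ℝ) • (Y + outer x)) ^ N)
      ≤ LinearMap.trace ℝ E (T ^ N)
        + ((1 + ‖x‖ ^ 2 / N) ^ N - 1) * inner ℝ e ((T ^ N) e) := by
    have hxe : (1 : E →ₗ[ℝ] E) + (1 / N : ℝ) • (Y + outer x) = T + (‖x‖ ^ 2 / N) • outer e := by
      ext v
      simp only [LinearMap.add_apply, LinearMap.smul_apply, outer_apply, he_def, hTdef,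
        inner_smul_left, smul_smul, smul_add, RCLike.conj_to_real, ← add_assoc]
      congr 2
      field_simp
    rw [hxe]
    have h2 := trace_rankOne_perturb_le hT he (t := ‖x‖ ^ 2 / N) (by positivity) N
    have h3 := inner_shift_pow_le (isPositive_smul hY (c := 1 / N) (by positivity)) e
      (t := ‖x‖ ^ 2 / N) (by positivity) N
    rw [← hTdef] at h3
    linarith
  have h2 : LinearMap.trace ℝ _ ((1 + (1 / N : ℝ) • compress (ℝ ∙ x)ᗮ Y) ^ N)
      ≤ LinearMap.trace ℝ E (T ^ N) - inner ℝ e ((T ^ N) e) := by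
    rw [← compress_smul, ← compress_one_add, hspan]
    exact trace_compress_pow_le hT he N
  -- Expected relative gain from a rejection against the loss from an inclusion. When p is capped at
  -- 1 the norm of x is unrestricted, but rejection has probability zero.
  have h3 : (1 - p) * ((1 + ‖x‖ ^ 2 / N) ^ N - 1) ≤ p := by
    rcases hxp with h | h
    · linarith [one_sub_mul_pow_le_one (sq_nonneg ‖x‖) h hN]
    · rw [h]; norm_num
  nlinarith [mul_le_mul_of_nonneg_left h1 (sub_nonneg.2 hp1), mul_le_mul_of_nonneg_left h2 hp0,
    mul_le_mul_of_nonneg_right h3 hT0]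

end

/-- Some vector orthogonal to the `ψ i`, `i ∈ B`, has a large energy for `Y + ∑ ψ i ψ iᵀ`. -/
def Missed {ι : Type*} {E : Type u} [NormedAddCommGroup E] [InnerProductSpace ℝ E]
    (L : ℝ) (s : Finset ι) (Y : E →ₗ[ℝ] E) (ψ : ι → E) (B : Finset ι) : Prop :=
  ∃ v : E, v ≠ 0 ∧ (∀ i ∈ B, inner ℝ (ψ i) v = 0) ∧
    L * ‖v‖ ^ 2 ≤ inner ℝ v (Y v) + ∑ i ∈ s, inner ℝ (ψ i) v ^ 2

/-- The probability that a random subset of `s`, whose elements are chosen independently with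
probabilities `p`, is `B`. -/
noncomputable def subsetProb {ι : Type*} [DecidableEq ι] (s : Finset ι) (p : ι → ℝ)
    (B : Finset ι) : ℝ :=
  ∏ i ∈ s, if i ∈ B then p i else 1 - p i

section

variable {ι : Type*} [DecidableEq ι]

theorem subsetProb_nonneg {s : Finset ι} {p : ι → ℝ} (hp0 : ∀ i ∈ s, 0 ≤ p i)
    (hp1 : ∀ i ∈ s, p i ≤ 1) (B : Finset ι) : 0 ≤ subsetProb s p B :=
  Finset.prod_nonneg fun i hi => by
    split_ifs
    · exact hp0 i hi
    · exact sub_nonneg.2 (hp1 i hi)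

theorem subsetProb_insert_left {s : Finset ι} {a : ι} (ha : a ∉ s) (p : ι → ℝ) {B : Finset ι}
    (hB : B ⊆ s) : subsetProb (insert a s) p B = (1 - p a) * subsetProb s p B := by
  unfold subsetProb
  rw [Finset.prod_insert ha, if_neg fun h => ha (hB h)]

theorem subsetProb_insert_insert {s : Finset ι} {a : ι} (ha : a ∉ s) (p : ι → ℝ) {B : Finset ι} :
    subsetProb (insert a s) p (insert a B) = p a * subsetProb s p B := by
  unfold subsetProb
  rw [Finset.prod_insert ha, if_pos (Finset.mem_insert_self a B)]
  congr 1
  refine Finset.prod_congr rfl fun i hi => ?_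
  have : i ≠ a := fun h => ha (h ▸ hi)
  simp [this]

-- Markov's inequality for the trace potential, by revealing the draws successively. Rejecting `a`
-- replaces `Y` by `Y + outer (ψ a)`; retaining it confines the witness to the complement of `ψ a`,
-- so the space itself changes and must be quantified inside the induction.
open Classical in
theorem sum_missed_mul_le_trace {N : ℕ} (hN : 0 < N) {L : ℝ} (hL : 0 ≤ L) (p : ι → ℝ)
    (s : Finset ι) : ∀ (E : Type u) [NormedAddCommGroup E] [InnerProductSpace ℝ E]
      [FiniteDimensional ℝ E] (Y : E →ₗ[ℝ] E) (_ : Y.IsPositive) (ψ : ι → E)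
      (_ : ∀ i ∈ s, 0 ≤ p i) (_ : ∀ i ∈ s, p i ≤ 1)
      (_ : ∀ i ∈ s, ‖ψ i‖ ^ 2 ≤ p i ∨ p i = 1),
      (∑ B ∈ s.powerset, if Missed L s Y ψ B then subsetProb s p B else 0) * (1 + L / N) ^ N
        ≤ LinearMap.trace ℝ E ((1 + (1 / N : ℝ) • Y) ^ N) := by
  have hN' : (0 : ℝ) < N := Nat.cast_pos.2 hN
  have hLN : 0 ≤ (1 + L / N) ^ N := by positivity
  induction s using Finset.induction_on with
  | empty =>
    intro E _ _ _ Y hY ψ _ _ _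
    have hT := one_add_smul_isPositive hY (c := 1 / N) (by positivity)
    simp only [Finset.powerset_empty, Finset.sum_singleton]
    -- No draw is left: a witness, once normalized, gives 1 + Y/N a quadratic form of at least 1 +
    -- L/N, hence its N-th power a trace of at least (1 + L/N)^N.
    split_ifs with h
    · obtain ⟨v, hv, -, hvL⟩ := h
      have hv' : 0 < ‖v‖ := norm_pos_iff.2 hv
      have he : ‖(‖v‖)⁻¹ • v‖ = 1 := by
        rw [norm_smul, norm_inv, norm_norm, inv_mul_cancel₀ hv'.ne']
      refine le_trans ?_ (inner_pow_le_trace hT he N)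
      simp only [subsetProb, Finset.prod_empty, one_mul]
      refine pow_le_pow_left₀ (by positivity) ?_ N
      have h1 : inner ℝ ((‖v‖)⁻¹ • v) ((1 + (1 / N : ℝ) • Y) ((‖v‖)⁻¹ • v))
          = 1 + (inner ℝ v (Y v) / ‖v‖ ^ 2) / N := by
        simp only [map_smul, inner_smul_left, inner_smul_right, LinearMap.add_apply,
          LinearMap.smul_apply, Module.End.one_apply, inner_add_right,
          real_inner_self_eq_norm_sq, RCLike.conj_to_real]
        field_simp
      rw [h1]
      gcongr
      rw [le_div_iff₀ (by positivity)]
      simpa using hvL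
    · rw [zero_mul, LinearMap.trace_eq_sum_inner _ (stdOrthonormalBasis ℝ _)]
      exact Finset.sum_nonneg fun i _ => inner_pow_nonneg hT _ _
  | insert a s ha ih =>
    intro E _ _ _ Y hY ψ hp0 hp1 hψ
    have hp0' : ∀ i ∈ s, 0 ≤ p i := fun i hi => hp0 i (Finset.mem_insert_of_mem hi)
    have hp1' : ∀ i ∈ s, p i ≤ 1 := fun i hi => hp1 i (Finset.mem_insert_of_mem hi)
    have hψ' : ∀ i ∈ s, ‖ψ i‖ ^ 2 ≤ p i ∨ p i = 1 := fun i hi =>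
      hψ i (Finset.mem_insert_of_mem hi)
    have hpa0 := hp0 a (Finset.mem_insert_self a s)
    have hpa1 := hp1 a (Finset.mem_insert_self a s)
    have hψa := hψ a (Finset.mem_insert_self a s)
    have hsum : ∀ v : E, inner ℝ v (Y v) + ∑ i ∈ insert a s, inner ℝ (ψ i) v ^ 2
        = inner ℝ v ((Y + outer (ψ a)) v) + ∑ i ∈ s, inner ℝ (ψ i) v ^ 2 := by
      intro v
      rw [Finset.sum_insert ha, LinearMap.add_apply, inner_add_right, outer_apply,
        inner_smul_right, real_inner_comm v (ψ a)]
      ring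
    have hleft : ∀ B, Missed L (insert a s) Y ψ B ↔ Missed L s (Y + outer (ψ a)) ψ B := by
      intro B
      simp only [Missed, hsum]
    rw [Finset.sum_powerset_insert ha]
    have e1 : (∑ B ∈ s.powerset,
        if Missed L (insert a s) Y ψ B then subsetProb (insert a s) p B else 0)
        = (1 - p a) * ∑ B ∈ s.powerset,
          if Missed L s (Y + outer (ψ a)) ψ B then subsetProb s p B else 0 := by
      rw [Finset.mul_sum]
      refine Finset.sum_congr rfl fun B hB => ?_
      rw [subsetProb_insert_left ha p (Finset.mem_powerset.1 hB), mul_ite, mul_zero]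
      simp only [hleft]
    rw [e1]
    -- A zero vector defines no direction to compress; both outcomes of its draw leave the problem
    -- unchanged.
    by_cases hx : ψ a = 0
    · have e2 : (∑ B ∈ s.powerset,
          if Missed L (insert a s) Y ψ (insert a B)
            then subsetProb (insert a s) p (insert a B) else 0)
          = p a * ∑ B ∈ s.powerset,
            if Missed L s (Y + outer (ψ a)) ψ B then subsetProb s p B else 0 := by
        rw [Finset.mul_sum]
        refine Finset.sum_congr rfl fun B hB => ?_
        rw [subsetProb_insert_insert ha p, mul_ite, mul_zero]
        simp only [hleft]
        congr 1
        simp [Missed, hx]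
      have hYx : Y + outer (ψ a) = Y := by
        ext v
        simp [hx]
      rw [e2, ← add_mul, sub_add_cancel, one_mul, hYx]
      exact ih E Y hY ψ hp0' hp1' hψ'
    · set K : Submodule ℝ E := (ℝ ∙ ψ a)ᗮ with hK
      set ψ' : ι → K := fun i => K.orthogonalProjectionOnto (ψ i) with hψ'def
      have e2 : (∑ B ∈ s.powerset,
          if Missed L (insert a s) Y ψ (insert a B)
            then subsetProb (insert a s) p (insert a B) else 0)
          ≤ p a * ∑ B ∈ s.powerset,
            if Missed L s (compress K Y) ψ' B then subsetProb s p B else 0 := by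
        rw [Finset.mul_sum]
        refine Finset.sum_le_sum fun B hB => ?_
        rw [subsetProb_insert_insert ha p, mul_ite, mul_zero]
        have himp : Missed L (insert a s) Y ψ (insert a B) → Missed L s (compress K Y) ψ' B := by
          rintro ⟨v, hv, hvB, hvL⟩
          have hva := hvB a (Finset.mem_insert_self a B)
          have hvK : v ∈ K := Submodule.mem_orthogonal_singleton_iff_inner_right.2 hva
          refine ⟨⟨v, hvK⟩, fun h => hv (congrArg Subtype.val h), fun i hi => ?_, ?_⟩
          · rw [hψ'def]
            simpa using hvB i (Finset.mem_insert_of_mem hi)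
          · rw [inner_compress]
            rw [Finset.sum_insert ha, hva] at hvL
            simpa [hψ'def] using hvL
        have hnn : 0 ≤ p a * subsetProb s p B := mul_nonneg hpa0 (subsetProb_nonneg hp0' hp1' B)
        by_cases h : Missed L (insert a s) Y ψ (insert a B)
        · rw [if_pos h, if_pos (himp h)]
        · rw [if_neg h]
          split_ifs
          · exact hnn
          · exact le_rfl
      have h1 := ih E (Y + outer (ψ a)) (hY.add (outer_isPositive _)) ψ hp0' hp1' hψ'
      have h2 := ih K (compress K Y) (compress_isPositive K hY) ψ' hp0' hp1' fun i hi => by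
        refine (hψ' i hi).imp_left fun h => le_trans ?_ h
        gcongr
        exact K.norm_orthogonalProjectionOnto_apply_le (ψ i)
      refine le_trans ?_ (trace_step_le hY hx hpa0 hpa1 hψa hN)
      nlinarith [mul_le_mul_of_nonneg_left h1 (sub_nonneg.2 hpa1),
        mul_le_mul_of_nonneg_left h2 hpa0, mul_le_mul_of_nonneg_right e2 hLN]

open Classical in
/-- A Chernoff bound for the random inclusion of vectors. -/
theorem sum_missed_le {E : Type u} [NormedAddCommGroup E] [InnerProductSpace ℝ E]
    [FiniteDimensional ℝ E] {L : ℝ} (hL : 0 ≤ L) (s : Finset ι) (p : ι → ℝ) (ψ : ι → E)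
    (hp0 : ∀ i ∈ s, 0 ≤ p i) (hp1 : ∀ i ∈ s, p i ≤ 1)
    (hψ : ∀ i ∈ s, ‖ψ i‖ ^ 2 ≤ p i ∨ p i = 1) :
    (∑ B ∈ s.powerset, if Missed L s (0 : E →ₗ[ℝ] E) ψ B then subsetProb s p B else 0)
      ≤ Module.finrank ℝ E * Real.exp (-L) := by
  set X := ∑ B ∈ s.powerset, if Missed L s (0 : E →ₗ[ℝ] E) ψ B then subsetProb s p B else 0
  have h1 : X * Real.exp L ≤ Module.finrank ℝ E := by
    -- For Y = 0 the trace is the dimension for every N, while (1 + L/N)^N tends to exp L.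
    refine le_of_tendsto ((Real.tendsto_one_add_div_pow_exp L).const_mul X) ?_
    filter_upwards [Filter.eventually_gt_atTop 0] with N hN
    have := sum_missed_mul_le_trace hN hL p s E 0 LinearMap.isPositive_zero ψ hp0 hp1 hψ
    simpa using this
  rw [Real.exp_neg, ← div_eq_mul_inv, le_div_iff₀ (Real.exp_pos L)]
  exact h1

open Classical in
/-- The Chernoff bound for the random inclusion of vectors, with the number of vectors in place
of the dimension. -/
theorem sum_missed_le_card {E : Type u} [NormedAddCommGroup E] [InnerProductSpace ℝ E]
    [FiniteDimensional ℝ E] {L : ℝ} (hL : 0 < L) (s : Finset ι) (p : ι → ℝ) (ψ : ι → E)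
    (hp0 : ∀ i ∈ s, 0 ≤ p i) (hp1 : ∀ i ∈ s, p i ≤ 1)
    (hψ : ∀ i ∈ s, ‖ψ i‖ ^ 2 ≤ p i ∨ p i = 1) :
    (∑ B ∈ s.powerset, if Missed L s (0 : E →ₗ[ℝ] E) ψ B then subsetProb s p B else 0)
      ≤ s.card * Real.exp (-L) := by
  -- Projecting a witness to the span of the vectors keeps its inner products with them and does not
  -- increase its norm, so the dimension may be replaced by the number of vectors.
  set K : Submodule ℝ E := Submodule.span ℝ (s.image ψ : Finset E) with hK
  have hψK : ∀ i ∈ s, ψ i ∈ K := fun i hi =>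
    Submodule.subset_span (Finset.mem_coe.2 (Finset.mem_image_of_mem ψ hi))
  set ψ' : ι → K := fun i => K.orthogonalProjectionOnto (ψ i) with hψ'
  have hin : ∀ i ∈ s, ∀ v : E, inner ℝ (ψ' i) (K.orthogonalProjectionOnto v) = inner ℝ (ψ i) v := by
    intro i hi v
    have h1 : ψ' i = ⟨ψ i, hψK i hi⟩ :=
      Submodule.orthogonalProjectionOnto_mem_subspace_eq_self (⟨ψ i, hψK i hi⟩ : K)
    rw [h1]
    simp
  refine le_trans ?_ ((sum_missed_le hL.le s p ψ' hp0 hp1 fun i hi => ?_).trans ?_)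
  · refine Finset.sum_le_sum fun B hB => ?_
    have himp : Missed L s (0 : E →ₗ[ℝ] E) ψ B → Missed L s (0 : K →ₗ[ℝ] K) ψ' B := by
      rintro ⟨v, hv, hvB, hvL⟩
      have e1 : ∑ i ∈ s, inner ℝ (ψ' i) (K.orthogonalProjectionOnto v) ^ 2
          = ∑ i ∈ s, inner ℝ (ψ i) v ^ 2 :=
        Finset.sum_congr rfl fun i hi => by rw [hin i hi]
      simp only [LinearMap.zero_apply, inner_zero_right, zero_add] at hvL
      refine ⟨K.orthogonalProjectionOnto v, fun h => ?_, fun i hi => ?_, ?_⟩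
      · rw [← e1, h] at hvL
        have hv' : 0 < ‖v‖ := norm_pos_iff.2 hv
        have : 0 < L * ‖v‖ ^ 2 := by positivity
        simp at hvL
        linarith
      · rw [hin i (Finset.mem_powerset.1 hB hi), hvB i hi]
      · simp only [LinearMap.zero_apply, inner_zero_right, zero_add]
        rw [e1]
        refine le_trans ?_ hvL
        gcongr
        exact K.norm_orthogonalProjectionOnto_apply_le v
    by_cases h : Missed L s (0 : E →ₗ[ℝ] E) ψ B
    · rw [if_pos h, if_pos (himp h)]
    · rw [if_neg h]
      split_ifs
      · exact subsetProb_nonneg hp0 hp1 B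
      · exact le_rfl
  · refine (hψ i hi).imp_left fun h => le_trans ?_ h
    gcongr
    exact K.norm_orthogonalProjectionOnto_apply_le (ψ i)
  · gcongr
    exact (finrank_span_finset_le_card _).trans Finset.card_image_le

end

end Chernoff

open Matrix

/-! ### The Nyström embedding as an orthogonal projection of features. -/

section Nystrom

theorem continuousOn_spectrum {n : Type*} [Fintype n] [DecidableEq n] (M : Matrix n n ℝ)
    (g : ℝ → ℝ) : ContinuousOn g (spectrum ℝ M) :=
  (Matrix.finite_real_spectrum (A := M)).continuousOn g

theorem spectrum_nonneg {n : Type*} [Fintype n] [DecidableEq n] {M : Matrix n n ℝ}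
    (hM : M.PosSemidef) {v : ℝ} (hv : v ∈ spectrum ℝ M) : 0 ≤ v := by
  rw [hM.1.spectrum_real_eq_range_eigenvalues] at hv
  obtain ⟨i, rfl⟩ := hv
  exact hM.eigenvalues_nonneg i

theorem transpose_cfc {n : Type*} [Fintype n] [DecidableEq n] (M : Matrix n n ℝ) (g : ℝ → ℝ) :
    (cfc g M)ᵀ = cfc g M := by
  have h : IsSelfAdjoint (cfc g M) := cfc_predicate g M
  rw [← conjTranspose_eq_transpose_of_trivial]
  exact h

theorem pinvSqrt_mul_pinvSqrt_mul_mul {n : Type*} [Fintype n] [DecidableEq n]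
    {M : Matrix n n ℝ} (hM : M.PosSemidef) :
    pinvSqrt M * pinvSqrt M * M * pinvSqrt M = pinvSqrt M := by
  have hc := continuousOn_spectrum M
  have hid : cfc (fun v : ℝ => v) M = M := cfc_id' ℝ M hM.1
  unfold pinvSqrt
  conv_lhs => rw [← hid]
  rw [hid, ← cfc_mul _ _ M (hc _) (hc _)]
  nth_rw 2 [← hid]
  rw [← cfc_mul _ _ M (hc _) (hc _), ← cfc_mul _ _ M (hc _) (hc _)]
  refine cfc_congr fun v hv => ?_
  have hv0 := spectrum_nonneg hM hv
  rcases hv0.eq_or_lt with h | h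
  · simp [← h]
  · have hs : 0 < √v := Real.sqrt_pos.2 h
    have : v = √v * √v := (Real.mul_self_sqrt hv0).symm
    nth_rw 3 [this]
    field_simp

theorem mul_pinvSqrt_mul_pinvSqrt_mul {n : Type*} [Fintype n] [DecidableEq n]
    {M : Matrix n n ℝ} (hM : M.PosSemidef) :
    M * pinvSqrt M * pinvSqrt M * M = M := by
  have hc := continuousOn_spectrum M
  have hid : cfc (fun v : ℝ => v) M = M := cfc_id' ℝ M hM.1
  have key : cfc (fun v : ℝ => v) M * pinvSqrt M * pinvSqrt M * cfc (fun v : ℝ => v) M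
      = cfc (fun v : ℝ => v) M := by
    unfold pinvSqrt
    rw [← cfc_mul _ _ M (hc _) (hc _), ← cfc_mul _ _ M (hc _) (hc _),
      ← cfc_mul _ _ M (hc _) (hc _)]
    refine cfc_congr fun v hv => ?_
    have hv0 := spectrum_nonneg hM hv
    rcases hv0.eq_or_lt with h | h
    · simp [← h]
    · have hs : 0 < √v := Real.sqrt_pos.2 h
      have : v = √v * √v := (Real.mul_self_sqrt hv0).symm
      calc v * (√v)⁻¹ * (√v)⁻¹ * v = v * (√v * √v)⁻¹ * v := by rw [mul_inv]; ring
        _ = v := by rw [← this]; field_simp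
  rwa [hid] at key

/-- A positive semidefinite matrix is a Gram matrix. -/
theorem exists_transpose_mul_self {n : Type*} [Fintype n] [DecidableEq n]
    {M : Matrix n n ℝ} (hM : M.PosSemidef) : ∃ R : Matrix n n ℝ, M = Rᵀ * R := by
  have hc := continuousOn_spectrum M
  refine ⟨cfc Real.sqrt M, ?_⟩
  rw [transpose_cfc, ← cfc_mul _ _ M (hc _) (hc _)]
  conv_lhs => rw [← cfc_id' ℝ M hM.1]
  exact cfc_congr fun v hv => (Real.mul_self_sqrt (spectrum_nonneg hM hv)).symm

variable {A : Type*} [Fintype A] [DecidableEq A]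

/-- The feature vector of a candidate. -/
def feat (R : Matrix A A ℝ) (a : A) : A → ℝ := fun j => R j a

/-- The matrix whose rows are the feature vectors of the first `t` candidates. -/
def featMat (R : Matrix A A ℝ) (x : ℕ → A) (t : ℕ) : Matrix (Fin t) A ℝ :=
  Matrix.of fun i => feat R (x (i + 1))

/-- The regularized covariance of the first `t` candidates, projected by `Q`. -/
def regCov (R : Matrix A A ℝ) (lam : ℝ) (Q : Matrix A A ℝ) (x : ℕ → A) (t : ℕ) : Matrix A A ℝ :=
  Q * ((featMat R x t)ᵀ * featMat R x t) * Q + lam • (1 : Matrix A A ℝ)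

/-- The orthogonal projection onto the span of the features of the dictionary. -/
structure IsProj (R : Matrix A A ℝ) (S : Finset A) (Q : Matrix A A ℝ) : Prop where
  symm : Qᵀ = Q
  idem : Q * Q = Q
  fix : ∀ s ∈ S, Q *ᵥ feat R s = feat R s
  kill : ∀ v, (∀ s ∈ S, feat R s ⬝ᵥ v = 0) → Q *ᵥ v = 0

theorem posSemidef_transpose_mul_self {m n : Type*} [Fintype m] [Fintype n]
    (X : Matrix m n ℝ) : (Xᵀ * X).PosSemidef := by
  rw [← conjTranspose_eq_transpose_of_trivial]
  exact posSemidef_conjTranspose_mul_self X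

theorem posDef_add_smul_one {n : Type*} [Fintype n] [DecidableEq n] {M : Matrix n n ℝ}
    (hM : M.PosSemidef) {lam : ℝ} (hlam : 0 < lam) : (M + lam • (1 : Matrix n n ℝ)).PosDef :=
  PosDef.posSemidef_add hM (PosDef.one.smul hlam)

/-- The approximate posterior variance is a quadratic form of the inverse of a projected
covariance. -/
theorem exists_proj_approxVar {k R : Matrix A A ℝ} (hk : k = Rᵀ * R) {lam : ℝ} (hlam : 0 < lam)
    (S : Finset A) : ∃ Q : Matrix A A ℝ, IsProj R S Q ∧ ∀ x t a,
      ∃ y, regCov R lam Q x t *ᵥ y = feat R a ∧ approxVar k lam S x t a = feat R a ⬝ᵥ y := by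
  have hkf : ∀ a b, k a b = feat R a ⬝ᵥ feat R b := fun a b => by
    rw [hk]; rfl
  set F : Matrix S A ℝ := Matrix.of fun s => feat R s with hF
  have hgram : gram k S = F * Fᵀ := by
    ext i j
    simp only [gram, Matrix.of_apply, hkf]
    rfl
  have hM : (gram k S).PosSemidef := by
    have := posSemidef_transpose_mul_self Fᵀ
    rwa [transpose_transpose, ← hgram] at this
  set P := pinvSqrt (gram k S) with hP
  have hPt : Pᵀ = P := transpose_cfc _ _
  set J : Matrix S A ℝ := P * F with hJ
  have hJt : Jᵀ = Fᵀ * P := by rw [hJ, transpose_mul, hPt]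
  -- `J` is a partial isometry, so `Jᵀ * J` is the projection sought.
  have hJJJ : Jᵀ * J * Jᵀ = Jᵀ := by
    calc Jᵀ * J * Jᵀ = Fᵀ * (P * P * (F * Fᵀ) * P) := by
          rw [hJt, hJ]; simp only [Matrix.mul_assoc]
      _ = Jᵀ := by rw [← hgram, pinvSqrt_mul_pinvSqrt_mul_mul hM, hJt]
  have hQQ : Jᵀ * J * (Jᵀ * J) = Jᵀ * J := by rw [← Matrix.mul_assoc, hJJJ]
  have hfix : Jᵀ * J * Fᵀ = Fᵀ := by
    -- The Gram matrix of the defect vanishes, hence so does the defect.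
    have h0 : (Jᵀ * J * Fᵀ - Fᵀ)ᵀ * (Jᵀ * J * Fᵀ - Fᵀ) = 0 := by
      have h2 : F * (Jᵀ * J) * Fᵀ = F * Fᵀ := by
        calc F * (Jᵀ * J) * Fᵀ = (F * Fᵀ) * P * P * (F * Fᵀ) := by
              rw [hJt, hJ]; simp only [Matrix.mul_assoc]
          _ = F * Fᵀ := by rw [← hgram]; exact mul_pinvSqrt_mul_pinvSqrt_mul hM
      have h3 : (Jᵀ * J * Fᵀ)ᵀ = F * (Jᵀ * J) := by
        simp only [transpose_mul, transpose_transpose, Matrix.mul_assoc]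
      rw [transpose_sub, h3, transpose_transpose, Matrix.sub_mul, Matrix.mul_sub, Matrix.mul_sub,
        h2, ← Matrix.mul_assoc, Matrix.mul_assoc F, hQQ, h2, ← Matrix.mul_assoc, h2]
      simp
    rw [← conjTranspose_eq_transpose_of_trivial, conjTranspose_mul_self_eq_zero] at h0
    exact sub_eq_zero.1 h0
  have hembed : ∀ a, embed k S a = J *ᵥ feat R a := fun a => by
    unfold embed
    rw [hJ, ← mulVec_mulVec]
    congr 1
    ext i
    rw [hkf]
    rfl
  refine ⟨Jᵀ * J, ⟨by simp [transpose_mul], hQQ, ?_, ?_⟩, ?_⟩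
  · intro s hs
    have : feat R s = Fᵀ *ᵥ Pi.single ⟨s, hs⟩ 1 := by
      rw [mulVec_single_one]
      rfl
    rw [this, mulVec_mulVec, hfix]
  · intro v hv
    have : F *ᵥ v = 0 := by
      ext i
      exact hv i i.2
    rw [← mulVec_mulVec, hJ, ← mulVec_mulVec, this]
    simp
  · intro x t a
    set X := featMat R x t with hX
    have hmat : embedMat k S x t = X * Jᵀ := by
      ext i j
      simp only [embedMat, Matrix.of_apply, hembed]
      rw [mulVec, dotProduct_comm]
      rfl
    have hD : designMat k lam S x t = J * (Xᵀ * X) * Jᵀ + lam • (1 : Matrix S S ℝ) := by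
      unfold designMat
      rw [hmat, transpose_mul, transpose_transpose]
      simp only [Matrix.mul_assoc]
    have hDpos : (designMat k lam S x t).PosDef :=
      posDef_add_smul_one (posSemidef_transpose_mul_self _) hlam
    have hDu : IsUnit (designMat k lam S x t).det := (isUnit_iff_isUnit_det _).1 hDpos.isUnit
    set w := (designMat k lam S x t)⁻¹ *ᵥ (J *ᵥ feat R a) with hw
    have hDw : designMat k lam S x t *ᵥ w = J *ᵥ feat R a := by
      rw [hw, mulVec_mulVec, mul_nonsing_inv _ hDu, one_mulVec]
    rw [hD, add_mulVec, smul_mulVec, one_mulVec] at hDw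
    -- The projected covariance is λ on the kernel of the projection, which gives the first term; on
    -- its range it is conjugated by `J` to the design matrix, which gives the second.
    refine ⟨(1 / lam) • (feat R a - (Jᵀ * J) *ᵥ feat R a) + Jᵀ *ᵥ w, ?_, ?_⟩
    · have h1 : (Jᵀ * J) *ᵥ ((1 / lam) • (feat R a - (Jᵀ * J) *ᵥ feat R a) + Jᵀ *ᵥ w)
          = Jᵀ *ᵥ w := by
        rw [mulVec_add, mulVec_smul, mulVec_sub, mulVec_mulVec, mulVec_mulVec, hJJJ,
          hQQ]
        simp
      have h2 : Jᵀ *ᵥ ((J * (Xᵀ * X) * Jᵀ) *ᵥ w + lam • w) = (Jᵀ * J) *ᵥ feat R a := by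
        rw [hDw, mulVec_mulVec]
      unfold regCov
      rw [add_mulVec, ← mulVec_mulVec, h1, smul_mulVec, one_mulVec, smul_add, smul_smul,
        mul_one_div_cancel hlam.ne', one_smul]
      rw [mulVec_add, mulVec_smul, mulVec_mulVec] at h2
      rw [← hX, mulVec_mulVec, add_left_comm]
      simp only [Matrix.mul_assoc] at h2 ⊢
      rw [h2]
      abel
    · have hadj : ∀ u, feat R a ⬝ᵥ Jᵀ *ᵥ u = J *ᵥ feat R a ⬝ᵥ u := fun u => by
        rw [dotProduct_mulVec, vecMul_transpose]
      unfold approxVar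
      rw [hembed, hkf, dotProduct_add, dotProduct_smul, dotProduct_sub, smul_eq_mul]
      congr 1
      · have h3 : feat R a ⬝ᵥ (Jᵀ * J) *ᵥ feat R a = J *ᵥ feat R a ⬝ᵥ J *ᵥ feat R a := by
          rw [← hadj, mulVec_mulVec]
        rw [h3]
      · rw [← hw, hadj]

end Nystrom

/-! ### From residual energy to variance accuracy, and from one dictionary to the next. -/

section Residual

variable {A : Type*} [Fintype A]

/-- The energy `∑ ⟨φ(x_s), v⟩²` of a vector. -/
def energy (R : Matrix A A ℝ) (x : ℕ → A) (t : ℕ) (v : A → ℝ) : ℝ :=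
  ∑ s ∈ Finset.Icc 1 t, (feat R (x s) ⬝ᵥ v) ^ 2

/-- The residual covariance of the first `t` candidates off the span of the dictionary is at most
`c * lam`. -/
def ResidualLE (R : Matrix A A ℝ) (lam c : ℝ) (x : ℕ → A) (t : ℕ) (S : Finset A) : Prop :=
  ∀ v, (∀ s ∈ S, feat R s ⬝ᵥ v = 0) → energy R x t v ≤ c * (lam * (v ⬝ᵥ v))

theorem energy_nonneg (R : Matrix A A ℝ) (x : ℕ → A) (t : ℕ) (v : A → ℝ) : 0 ≤ energy R x t v :=
  Finset.sum_nonneg fun _ _ => sq_nonneg _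

theorem energy_mono (R : Matrix A A ℝ) (x : ℕ → A) {m n : ℕ} (h : m ≤ n) (v : A → ℝ) :
    energy R x m v ≤ energy R x n v :=
  Finset.sum_le_sum_of_subset_of_nonneg (Finset.Icc_subset_Icc_right h) fun _ _ _ => sq_nonneg _

theorem dotProduct_self_nonneg' (v : A → ℝ) : 0 ≤ v ⬝ᵥ v :=
  Finset.sum_nonneg fun _ _ => mul_self_nonneg _

theorem add_sq_le_weighted {β : ℝ} (hβ : 0 < β) (a b : ℝ) :
    (a + b) ^ 2 ≤ (1 + β) * a ^ 2 + (1 + 1 / β) * b ^ 2 := by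
  have h : (1 + β) * a ^ 2 + (1 + 1 / β) * b ^ 2 - (a + b) ^ 2 = (β * a - b) ^ 2 / β := by
    field_simp
    ring
  have : 0 ≤ (β * a - b) ^ 2 / β := by positivity
  linarith

theorem energy_add_le (R : Matrix A A ℝ) (x : ℕ → A) (t : ℕ) {β : ℝ} (hβ : 0 < β)
    (u w : A → ℝ) :
    energy R x t (u + w) ≤ (1 + β) * energy R x t u + (1 + 1 / β) * energy R x t w := by
  unfold energy
  rw [Finset.mul_sum, Finset.mul_sum, ← Finset.sum_add_distrib]
  refine Finset.sum_le_sum fun s _ => ?_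
  rw [dotProduct_add]
  exact add_sq_le_weighted hβ _ _

theorem energy_neg (R : Matrix A A ℝ) (x : ℕ → A) (t : ℕ) (v : A → ℝ) :
    energy R x t (-v) = energy R x t v := by
  simp [energy]

/-- Comparison of the quadratic forms of the inverses. -/
theorem dotProduct_le_of_form_le {M₁ M₂ : Matrix A A ℝ} (h₁ : M₁ᵀ = M₁)
    (hpos : ∀ v, 0 ≤ v ⬝ᵥ M₁ *ᵥ v) {K : ℝ} (hK : 0 < K)
    (hle : ∀ v, v ⬝ᵥ M₁ *ᵥ v ≤ K * (v ⬝ᵥ M₂ *ᵥ v)) {φ y₁ y₂ : A → ℝ} (hy₁ : M₁ *ᵥ y₁ = φ)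
    (hy₂ : M₂ *ᵥ y₂ = φ) : φ ⬝ᵥ y₂ ≤ K * (φ ⬝ᵥ y₁) := by
  -- Expanding the nonnegative form of `M₁` at `y₂ - K • y₁` and bounding its first term by `hle`
  -- gives the claim multiplied by `K`.
  have e1 : (y₂ - K • y₁) ⬝ᵥ M₁ *ᵥ (y₂ - K • y₁)
      = y₂ ⬝ᵥ M₁ *ᵥ y₂ - 2 * K * (φ ⬝ᵥ y₂) + K ^ 2 * (φ ⬝ᵥ y₁) := by
    have e2 : y₁ ⬝ᵥ M₁ *ᵥ y₂ = φ ⬝ᵥ y₂ := by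
      rw [dotProduct_mulVec, ← mulVec_transpose, h₁, hy₁]
    rw [mulVec_sub, mulVec_smul, hy₁, sub_dotProduct, dotProduct_sub, dotProduct_sub,
      smul_dotProduct, smul_dotProduct, dotProduct_smul, dotProduct_smul, e2,
      dotProduct_comm y₂ φ, dotProduct_comm y₁ φ]
    simp only [smul_eq_mul]
    ring
  have h2 := hle y₂
  rw [hy₂, dotProduct_comm y₂ φ] at h2
  have h3 := hpos (y₂ - K • y₁)
  rw [e1] at h3
  nlinarith

namespace IsProj

variable {R Q : Matrix A A ℝ} {S : Finset A}

theorem dotProduct_eq (hQ : IsProj R S Q) {s : A} (hs : s ∈ S) (v : A → ℝ) :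
    feat R s ⬝ᵥ Q *ᵥ v = feat R s ⬝ᵥ v := by
  rw [dotProduct_mulVec, ← mulVec_transpose, hQ.symm, hQ.fix s hs]

theorem residual_orthogonal (hQ : IsProj R S Q) {s : A} (hs : s ∈ S) (v : A → ℝ) :
    feat R s ⬝ᵥ (v - Q *ᵥ v) = 0 := by
  rw [dotProduct_sub, hQ.dotProduct_eq hs, sub_self]

theorem residual_le (hQ : IsProj R S Q) (v : A → ℝ) : (v - Q *ᵥ v) ⬝ᵥ (v - Q *ᵥ v) ≤ v ⬝ᵥ v := by
  have h1 : Q *ᵥ v ⬝ᵥ Q *ᵥ v = v ⬝ᵥ Q *ᵥ v := by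
    rw [dotProduct_mulVec, ← mulVec_transpose, hQ.symm, mulVec_mulVec, hQ.idem, dotProduct_comm]
  have h2 := dotProduct_self_nonneg' (Q *ᵥ v)
  rw [sub_dotProduct, dotProduct_sub, dotProduct_sub, h1, dotProduct_comm (Q *ᵥ v) v]
  linarith

theorem energy_residual_le (hQ : IsProj R S Q) {lam c : ℝ} (hlam : 0 < lam) (hc : 0 ≤ c) {x : ℕ → A} {t : ℕ}
    (h : ResidualLE R lam c x t S) (v : A → ℝ) :
    energy R x t (v - Q *ᵥ v) ≤ c * (lam * (v ⬝ᵥ v)) :=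
  (h _ fun _ hs => hQ.residual_orthogonal hs v).trans <| by
    have := hQ.residual_le v
    gcongr

theorem energy_proj_le (hQ : IsProj R S Q) {lam c : ℝ} (hlam : 0 < lam) (hc : 0 ≤ c) {x : ℕ → A} {t : ℕ}
    (h : ResidualLE R lam c x t S) {β : ℝ} (hβ : 0 < β) (v : A → ℝ) :
    energy R x t (Q *ᵥ v)
      ≤ (1 + β) * energy R x t v + (1 + 1 / β) * (c * (lam * (v ⬝ᵥ v))) := by
  have h1 := energy_add_le R x t hβ v (-(v - Q *ᵥ v))
  rw [energy_neg, neg_sub, add_sub_cancel] at h1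
  have h2 := hQ.energy_residual_le hlam hc h v
  refine h1.trans ?_
  gcongr

theorem energy_le_proj (hQ : IsProj R S Q) {lam c : ℝ} (hlam : 0 < lam) (hc : 0 ≤ c) {x : ℕ → A} {t : ℕ}
    (h : ResidualLE R lam c x t S) {β : ℝ} (hβ : 0 < β) (v : A → ℝ) :
    energy R x t v
      ≤ (1 + β) * energy R x t (Q *ᵥ v) + (1 + 1 / β) * (c * (lam * (v ⬝ᵥ v))) := by
  have h1 := energy_add_le R x t hβ (Q *ᵥ v) (v - Q *ᵥ v)
  rw [add_sub_cancel] at h1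
  have h2 := hQ.energy_residual_le hlam hc h v
  refine h1.trans ?_
  gcongr

end IsProj

variable [DecidableEq A]

theorem dotProduct_regCov {R Q : Matrix A A ℝ} (hQ : Qᵀ = Q) (lam : ℝ) (x : ℕ → A) (t : ℕ)
    (v : A → ℝ) :
    v ⬝ᵥ regCov R lam Q x t *ᵥ v = energy R x t (Q *ᵥ v) + lam * (v ⬝ᵥ v) := by
  unfold regCov
  rw [add_mulVec, smul_mulVec, one_mulVec, dotProduct_add, dotProduct_smul, smul_eq_mul]
  congr 1
  have e1 : v ⬝ᵥ (Q * ((featMat R x t)ᵀ * featMat R x t) * Q) *ᵥ v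
      = (featMat R x t *ᵥ (Q *ᵥ v)) ⬝ᵥ (featMat R x t *ᵥ (Q *ᵥ v)) := by
    rw [← mulVec_mulVec, ← mulVec_mulVec, dotProduct_mulVec, ← mulVec_transpose, hQ,
      ← mulVec_mulVec, dotProduct_mulVec, vecMul_transpose]
  rw [e1]
  unfold energy
  have hI : Finset.Icc 1 t = Finset.Ico (0 + 1) (t + 1) := by
    ext
    simp
  rw [hI, ← Finset.sum_Ico_add' (fun s => (feat R (x s) ⬝ᵥ Q *ᵥ v) ^ 2) 0 t 1,
    ← Finset.range_eq_Ico,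
    ← Fin.sum_univ_eq_sum_range (fun s => (feat R (x (s + 1)) ⬝ᵥ Q *ᵥ v) ^ 2) t]
  exact Finset.sum_congr rfl fun i _ => (sq _).symm

theorem regCov_transpose {R Q : Matrix A A ℝ} (hQ : Qᵀ = Q) (lam : ℝ) (x : ℕ → A) (t : ℕ) :
    (regCov R lam Q x t)ᵀ = regCov R lam Q x t := by
  unfold regCov
  simp only [transpose_add, transpose_mul, transpose_smul, transpose_one, transpose_transpose, hQ,
    Matrix.mul_assoc]

theorem dotProduct_regCov_nonneg {R Q : Matrix A A ℝ} (hQ : Qᵀ = Q) {lam : ℝ} (hlam : 0 < lam)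
    (x : ℕ → A) (t : ℕ) (v : A → ℝ) : 0 ≤ v ⬝ᵥ regCov R lam Q x t *ᵥ v := by
  rw [dotProduct_regCov hQ]
  exact add_nonneg (energy_nonneg _ _ _ _) (mul_nonneg hlam.le (dotProduct_self_nonneg' v))

/-- If the residual covariance is at most `4 / 3 * lam`, the approximate posterior variances are
accurate up to a factor `3`. -/
theorem approxVar_accurate {k R : Matrix A A ℝ} (hk : k = Rᵀ * R) {lam : ℝ} (hlam : 0 < lam)
    {S : Finset A} {x : ℕ → A} {t : ℕ} (h : ResidualLE R lam (4 / 3) x t S) (a : A) :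
    exactVar k lam x t a / 3 ≤ approxVar k lam S x t a ∧
      approxVar k lam S x t a ≤ 3 * exactVar k lam x t a := by
  obtain ⟨Q, hQ, hv⟩ := exists_proj_approxVar hk hlam S
  obtain ⟨Q', hQ', hv'⟩ := exists_proj_approxVar hk hlam (Finset.univ : Finset A)
  obtain ⟨y, hy, hay⟩ := hv x t a
  obtain ⟨y', hy', hay'⟩ := hv' x t a
  have hform : ∀ v, v ⬝ᵥ regCov R lam Q' x t *ᵥ v = energy R x t v + lam * (v ⬝ᵥ v) := by
    intro v
    rw [dotProduct_regCov hQ'.symm]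
    congr 1
    unfold energy
    exact Finset.sum_congr rfl fun s _ => by rw [hQ'.dotProduct_eq (Finset.mem_univ _)]
  have hvv : ∀ v : A → ℝ, 0 ≤ lam * (v ⬝ᵥ v) := fun v =>
    mul_nonneg hlam.le (dotProduct_self_nonneg' v)
  unfold exactVar
  rw [hay, hay', div_le_iff₀ (by norm_num), mul_comm _ (3 : ℝ)]
  constructor
  · refine dotProduct_le_of_form_le (regCov_transpose hQ.symm lam x t)
      (dotProduct_regCov_nonneg hQ.symm hlam x t) (by norm_num) (fun v => ?_) hy hy'
    rw [dotProduct_regCov hQ.symm, hform]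
    -- With β = 2 the residual contributes (3/2)(4/3) = 2 multiples of λ|v|²; with the
    -- regularization this makes 3, matching the factor 1 + β = 3 of the energy.
    have := hQ.energy_proj_le hlam (by norm_num) h (β := 2) (by norm_num) v
    linarith
  · refine dotProduct_le_of_form_le (regCov_transpose hQ'.symm lam x t)
      (dotProduct_regCov_nonneg hQ'.symm hlam x t) (by norm_num) (fun v => ?_) hy' hy
    rw [dotProduct_regCov hQ.symm, hform]
    have := hQ.energy_le_proj hlam (by norm_num) h (β := 2) (by norm_num) v
    linarith

open Classical in
/-- The probability that a resparsification yields a large residual. -/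
theorem sum_not_residualLE_le {k R : Matrix A A ℝ} (hk : k = Rᵀ * R) {lam : ℝ} (hlam : 0 < lam)
    {c c' β h q : ℝ} (hc : 0 < c) (hc' : 0 ≤ c') (hβ : 0 < β) (hh : 0 < h) (hq : 0 < q)
    (hcond : h * (1 + (1 + 1 / β) * c' + (1 + β) * c) ≤ c) {x : ℕ → A} {S : Finset A}
    {m n : ℕ} (hmn : m ≤ n) (hold : S = ∅ ∨ ResidualLE R lam c' x m S) :
    (∑ B ∈ (Finset.Icc 1 n).powerset, if ¬ ResidualLE R lam c x n (B.image x)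
      then subsetProb (Finset.Icc 1 n) (inclProb k lam q S x m) B else 0)
      ≤ n * Real.exp (-(q * h)) := by
  obtain ⟨Q, hQ, hv⟩ := exists_proj_approxVar hk hlam S
  choose y hy hay using fun s : ℕ => hv x m (x s)
  set M := regCov R lam Q x m with hM
  have hMt : Mᵀ = M := regCov_transpose hQ.symm lam x m
  have hMpos : M.PosSemidef := by
    refine PosSemidef.of_dotProduct_mulVec_nonneg ?_ fun v => ?_
    · rw [IsHermitian, conjTranspose_eq_transpose_of_trivial, hMt]
    · simpa using dotProduct_regCov_nonneg hQ.symm hlam x m v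
  obtain ⟨D, hD⟩ := exists_transpose_mul_self hMpos
  have hDD : ∀ u v : A → ℝ, D *ᵥ u ⬝ᵥ D *ᵥ v = u ⬝ᵥ M *ᵥ v := by
    intro u v
    rw [hD, ← mulVec_mulVec, dotProduct_mulVec u, vecMul_transpose]
  have hφ : ∀ (s : ℕ) (v : A → ℝ), D *ᵥ y s ⬝ᵥ D *ᵥ v = feat R (x s) ⬝ᵥ v := by
    intro s v
    rw [hDD, dotProduct_mulVec, ← mulVec_transpose, hMt, hy]
  have hvar : ∀ s, approxVar k lam S x m (x s) = D *ᵥ y s ⬝ᵥ D *ᵥ y s := fun s => by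
    rw [hay, hφ]
  -- Whitening: `D` is a root of the old covariance M and ψ_s = √q · D M⁻¹φ(x_s). Then |ψ_s|² is the
  -- uncapped inclusion probability, and ⟨ψ_s, Dv⟩² = q⟨φ(x_s), v⟩².
  set ψ : ℕ → EuclideanSpace ℝ A := fun s => WithLp.toLp 2 (√q • (D *ᵥ y s)) with hψ
  have hq2 : √q * √q = q := Real.mul_self_sqrt hq.le
  have hψn : ∀ s, ‖ψ s‖ ^ 2 = q * approxVar k lam S x m (x s) := by
    intro s
    rw [← real_inner_self_eq_norm_sq, hψ, EuclideanSpace.inner_toLp_toLp, hvar]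
    simp only [star_trivial, smul_dotProduct, dotProduct_smul, smul_eq_mul]
    rw [← mul_assoc, hq2]
  have hψi : ∀ (s : ℕ) (v : A → ℝ),
      inner ℝ (ψ s) (WithLp.toLp 2 (D *ᵥ v)) = √q * (feat R (x s) ⬝ᵥ v) := by
    intro s v
    rw [hψ, EuclideanSpace.inner_toLp_toLp]
    simp only [star_trivial, dotProduct_smul, smul_eq_mul]
    rw [dotProduct_comm, hφ]
  have hp0 : ∀ s ∈ Finset.Icc 1 n, 0 ≤ inclProb k lam q S x m s := fun s _ => by
    unfold inclProb
    rw [← hψn]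
    positivity
  have hp1 : ∀ s ∈ Finset.Icc 1 n, inclProb k lam q S x m s ≤ 1 := fun s _ => min_le_left _ _
  have hψp : ∀ s ∈ Finset.Icc 1 n,
      ‖ψ s‖ ^ 2 ≤ inclProb k lam q S x m s ∨ inclProb k lam q S x m s = 1 := fun s _ => by
    unfold inclProb
    rw [hψn]
    rcases le_total 1 (q * approxVar k lam S x m (x s)) with h1 | h1
    · exact Or.inr (min_eq_left h1)
    · exact Or.inl (min_eq_right h1).ge
  have hform : ∀ v, v ⬝ᵥ M *ᵥ v
      ≤ (1 + (1 + 1 / β) * c') * (lam * (v ⬝ᵥ v)) + (1 + β) * energy R x n v := by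
    intro v
    have hvv : 0 ≤ lam * (v ⬝ᵥ v) := mul_nonneg hlam.le (dotProduct_self_nonneg' v)
    have hen := energy_nonneg R x n v
    rw [hM, dotProduct_regCov hQ.symm]
    -- For the empty dictionary the projection is zero and M is just λ, so no residual bound is
    -- needed; this is why an empty dictionary can later count as sharp.
    rcases hold with hS | hold
    · have : Q *ᵥ v = 0 := hQ.kill v (by simp [hS])
      have h0 : energy R x m 0 = 0 := by simp [energy]
      rw [this, h0]
      have : 0 ≤ (1 + 1 / β) * c' * (lam * (v ⬝ᵥ v)) := by positivity
      have : 0 ≤ (1 + β) * energy R x n v := by positivity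
      linarith
    · have h1 := hQ.energy_proj_le hlam hc' hold hβ v
      have h2 : (1 + β) * energy R x m v ≤ (1 + β) * energy R x n v := by
        have := energy_mono R x hmn v
        gcongr
      linarith
  have hcard : ((Finset.Icc 1 n).card : ℝ) = n := by simp
  refine le_trans ?_ ((sum_missed_le_card (mul_pos hq hh) (Finset.Icc 1 n)
    (inclProb k lam q S x m) ψ hp0 hp1 hψp).trans_eq (by rw [hcard]))
  refine Finset.sum_le_sum fun B hB => ?_
  have himp : ¬ ResidualLE R lam c x n (B.image x) →
      Missed (q * h) (Finset.Icc 1 n) (0 : EuclideanSpace ℝ A →ₗ[ℝ] EuclideanSpace ℝ A) ψ B := by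
    intro hbad
    unfold ResidualLE at hbad
    push Not at hbad
    obtain ⟨v, hvB, hvc⟩ := hbad
    have hvv : 0 ≤ lam * (v ⬝ᵥ v) := mul_nonneg hlam.le (dotProduct_self_nonneg' v)
    have hen : 0 < energy R x n v := lt_of_le_of_lt (by positivity) hvc
    have hsum : ∑ i ∈ Finset.Icc 1 n, inner ℝ (ψ i) (WithLp.toLp 2 (D *ᵥ v)) ^ 2
        = q * energy R x n v := by
      unfold energy
      rw [Finset.mul_sum]
      refine Finset.sum_congr rfl fun s _ => ?_
      rw [hψi, mul_pow, Real.sq_sqrt hq.le]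
    refine ⟨WithLp.toLp 2 (D *ᵥ v), fun h0 => ?_, fun s hs => ?_, ?_⟩
    · rw [h0] at hsum
      simp only [inner_zero_right] at hsum
      have : 0 < q * energy R x n v := mul_pos hq hen
      rw [← hsum] at this
      simp at this
    · rw [hψi, hvB (x s) (Finset.mem_image_of_mem x hs), mul_zero]
    · rw [hsum, LinearMap.zero_apply, inner_zero_right, zero_add, mul_assoc,
        ← real_inner_self_eq_norm_sq, EuclideanSpace.inner_toLp_toLp]
      simp only [star_trivial]
      rw [hDD]
      refine mul_le_mul_of_nonneg_left ?_ hq.le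
      -- A bad v has λ|v|² below energy/c. Inserting this in `hform`, `hcond` yields h · vᵀMv ≤
      -- energy; the inequality is proved after multiplication by c.
      have hg : 0 ≤ h * (1 + (1 + 1 / β) * c') := by positivity
      have h1 := mul_le_mul_of_nonneg_left (hform v) hh.le
      have h2 : h * (1 + (1 + 1 / β) * c') * (c * (lam * (v ⬝ᵥ v)))
          ≤ h * (1 + (1 + 1 / β) * c') * energy R x n v := mul_le_mul_of_nonneg_left hvc.le hg
      have h3 := mul_le_mul_of_nonneg_right hcond hen.le
      refine le_of_mul_le_mul_left ?_ hc
      nlinarith [mul_le_mul_of_nonneg_left h1 hc.le]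
  by_cases hb : ResidualLE R lam c x n (B.image x)
  · rw [if_neg (not_not.2 hb)]
    split_ifs
    · exact subsetProb_nonneg hp0 hp1 B
    · exact le_rfl
  · rw [if_pos hb, if_pos (himp hb)]

end Residual

/-! ### Dependence on the candidates selected so far only. -/

section Congruence

variable {A : Type*} {k : Matrix A A ℝ} {lam : ℝ} {x x' : ℕ → A} {t : ℕ}

theorem residualLE_congr [Fintype A] {R : Matrix A A ℝ} {c : ℝ} (S : Finset A)
    (h : ∀ s, 1 ≤ s → s ≤ t → x s = x' s) :
    ResidualLE R lam c x t S ↔ ResidualLE R lam c x' t S := by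
  have : energy R x t = energy R x' t := by
    ext v
    refine Finset.sum_congr rfl fun s hs => ?_
    rw [Finset.mem_Icc] at hs
    rw [h s hs.1 hs.2]
  unfold ResidualLE
  rw [this]

variable [DecidableEq A]

theorem approxVar_congr (S : Finset A) (h : ∀ s, 1 ≤ s → s ≤ t → x s = x' s) :
    approxVar k lam S x t = approxVar k lam S x' t := by
  have : embedMat k S x t = embedMat k S x' t := by
    ext i j
    simp only [embedMat, Matrix.of_apply]
    rw [h _ (Nat.le_add_left 1 i) i.2]
  ext a
  simp only [approxVar, designMat, this]

theorem continue_congr {C : ℝ} {r b : ℕ} (S : Finset A) (hb : b ≤ t)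
    (h : ∀ s, 1 ≤ s → s ≤ t + 1 → x s = x' s) :
    Continue k lam C r S x b t ↔ Continue k lam C r S x' b t := by
  unfold Continue approxStd
  rw [approxVar_congr (x' := x') S fun s h1 h2 => h s h1 (by omega)]
  have : ∀ s ∈ Finset.Icc (b + 1) (t + 1), x s = x' s := fun s hs => by
    rw [Finset.mem_Icc] at hs
    exact h s (by omega) hs.2
  rw [Finset.sum_congr rfl fun s hs => by rw [this s hs]]

end Congruence

set_option linter.unusedSectionVars false

/-! ### Measurability of the state of the run and the conditional failure bound. -/

namespace IsRun

variable {A : Type*} [Fintype A] [DecidableEq A] {Ω : Type*} [mΩ : MeasurableSpace Ω]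
  {P : Measure Ω} {k : Matrix A A ℝ} {lam C : ℝ} {r : ℕ} {q : ℕ → ℝ} {f : A → ℝ} {ξsq : NNReal}
  {T : ℕ} {ℱ : Filtration ℕ mΩ} {x : ℕ → Ω → A} {η : ℕ → Ω → ℝ} {α : ℕ → Ω → ℝ}
  {fb : ℕ → Ω → ℕ} {S : ℕ → Ω → Finset A} {z : ℕ → ℕ → Ω → Bool}

theorem fb_le (hrun : IsRun P k lam C r q f ξsq T ℱ x η α fb S z) :
    ∀ t ≤ T, ∀ ω, fb t ω ≤ t := by
  intro t
  induction t with
  | zero => intro _ ω; exact (hrun.fb_zero ω).le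
  | succ t ih =>
    intro ht ω
    by_cases h : Continue k lam C r (S t ω) (fun s => x s ω) (fb t ω) t
    · rw [(hrun.batch_step t ht ω h).1]
      exact (ih (by omega) ω).trans (Nat.le_succ t)
    · exact (hrun.resparsify_step t ht ω h).1.le

theorem measurableSet_x (hrun : IsRun P k lam C r q f ξsq T ℱ x η α fb S z) {t n s : ℕ}
    (hn : n < T) (hs1 : 1 ≤ s) (hs : s ≤ n + 1) (ht : n ≤ t) (a : A) :
    MeasurableSet[ℱ t] {ω | x s ω = a} := by
  obtain ⟨s, rfl⟩ := Nat.exists_eq_add_of_le' hs1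
  exact ℱ.mono (by omega : s ≤ t) _ (hrun.x_adapted s (by omega) a)

/-- A property of the state of the run is an event of the past. -/
theorem measurableSet_of_state {m : MeasurableSpace Ω} {t n : ℕ} [Nonempty A]
    (hx : ∀ s, 1 ≤ s → s ≤ n → ∀ a, MeasurableSet[m] {ω | x s ω = a})
    (hS : ∀ b S₀, MeasurableSet[m] {ω | fb t ω = b ∧ S t ω = S₀})
    (hfb : ∀ ω, fb t ω ≤ t)
    (p : (ℕ → A) → ℕ → Finset A → Prop)
    (hp : ∀ x x' b S, b ≤ t → (∀ s, 1 ≤ s → s ≤ n → x s = x' s) → (p x b S ↔ p x' b S)) :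
    MeasurableSet[m] {ω | p (fun s => x s ω) (fb t ω) (S t ω)} := by
  classical
  -- `x 0` and the candidates after `n` carry no measurability assumption. Only the candidates 1 to
  -- n are recorded and extended arbitrarily, which `p` cannot see; the event becomes a countable
  -- union.
  let ext : (Fin n → A) → ℕ → A := fun g s =>
    if h : 1 ≤ s ∧ s ≤ n then g ⟨s - 1, by omega⟩ else Classical.arbitrary A
  have hset : {ω | p (fun s => x s ω) (fb t ω) (S t ω)}
      = ⋃ (g : Fin n → A) (b : ℕ) (S₀ : Finset A) (_ : b ≤ t ∧ p (ext g) b S₀),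
        (⋂ i : Fin n, {ω | x (i + 1) ω = g i}) ∩ {ω | fb t ω = b ∧ S t ω = S₀} := by
    ext ω
    simp only [Set.mem_ofPred_eq, Set.mem_iUnion, Set.mem_inter_iff, Set.mem_iInter, exists_prop]
    constructor
    · intro h
      refine ⟨fun i => x (i + 1) ω, fb t ω, S t ω, ⟨hfb ω, ?_⟩, fun _ => rfl, rfl, rfl⟩
      refine (hp _ _ _ _ (hfb ω) fun s h1 h2 => ?_).1 h
      have hs : s - 1 + 1 = s := Nat.sub_add_cancel h1
      simp only [ext, dif_pos (And.intro h1 h2), hs]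
    · rintro ⟨g, b, S₀, ⟨hb, h⟩, hg, rfl, rfl⟩
      refine (hp _ _ _ _ (hfb ω) fun s h1 h2 => ?_).1 h
      have := hg ⟨s - 1, by omega⟩
      have hs : s - 1 + 1 = s := Nat.sub_add_cancel h1
      simp only [ext, dif_pos (And.intro h1 h2)]
      rw [← this]
      simp only [hs]
  rw [hset]
  refine MeasurableSet.iUnion fun g => MeasurableSet.iUnion fun b => MeasurableSet.iUnion fun S₀ =>
    MeasurableSet.iUnion fun _ => MeasurableSet.inter (MeasurableSet.iInter fun i => ?_) (hS b S₀)
  exact hx _ (by omega) (by omega) _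

theorem measurableSet_draw (hrun : IsRun P k lam C r q f ξsq T ℱ x η α fb S z) {t : ℕ}
    (ht : t < T) (B : Finset ℕ) :
    MeasurableSet[ℱ (t + 1)]
      {ω | ((Finset.Icc 1 (t + 1)).filter fun s => z (t + 1) s ω = true) = B} := by
  have hset : {ω | ((Finset.Icc 1 (t + 1)).filter fun s => z (t + 1) s ω = true) = B}
      = ⋂ s : ℕ, {ω | (s ∈ Finset.Icc 1 (t + 1) ∧ z (t + 1) s ω = true) ↔ s ∈ B} := by
    ext ω
    simp [Finset.ext_iff]
  rw [hset]
  refine MeasurableSet.iInter fun s => ?_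
  have h1 : MeasurableSet[ℱ (t + 1)] {ω | z (t + 1) s ω = true} :=
    hrun.z_adapted t ht s (measurableSet_singleton true)
  exact ((MeasurableSet.const _).inter h1).iff (MeasurableSet.const _)

theorem measurableSet_state (hrun : IsRun P k lam C r q f ξsq T ℱ x η α fb S z) [Nonempty A] :
    ∀ t ≤ T, ∀ b S₀, MeasurableSet[ℱ t] {ω | fb t ω = b ∧ S t ω = S₀} := by
  intro t
  induction t with
  | zero =>
    intro _ b S₀
    simp only [hrun.fb_zero, hrun.S_zero]
    exact MeasurableSet.const _
  | succ t ih =>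
    intro ht b S₀
    have hx : ∀ s, 1 ≤ s → s ≤ t + 1 → ∀ a, MeasurableSet[ℱ (t + 1)] {ω | x s ω = a} :=
      fun s h1 h2 a => hrun.measurableSet_x ht h1 h2 (Nat.le_succ t) a
    have hst : ∀ b S₀, MeasurableSet[ℱ (t + 1)] {ω | fb t ω = b ∧ S t ω = S₀} :=
      fun b S₀ => ℱ.mono (Nat.le_succ t) _ (ih (by omega) b S₀)
    have hfb := hrun.fb_le t (by omega)
    have hset : {ω | fb (t + 1) ω = b ∧ S (t + 1) ω = S₀}
        = {ω | Continue k lam C r (S t ω) (fun s => x s ω) (fb t ω) t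
            ∧ fb t ω = b ∧ S t ω = S₀}
          ∪ ⋃ B ∈ (Finset.Icc 1 (t + 1)).powerset,
            ({ω | ¬ Continue k lam C r (S t ω) (fun s => x s ω) (fb t ω) t
                ∧ t + 1 = b ∧ B.image (fun s => x s ω) = S₀}
              ∩ {ω | ((Finset.Icc 1 (t + 1)).filter fun s => z (t + 1) s ω = true) = B}) := by
      ext ω
      simp only [Set.mem_ofPred_eq, Set.mem_union, Set.mem_iUnion, Set.mem_inter_iff, exists_prop]
      by_cases h : Continue k lam C r (S t ω) (fun s => x s ω) (fb t ω) t
      · obtain ⟨h1, h2⟩ := hrun.batch_step t ht ω h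
        simp [h, h1, h2]
      · obtain ⟨h1, h2⟩ := hrun.resparsify_step t ht ω h
        rw [h1, h2]
        simp only [h, false_and, not_false_eq_true, true_and, false_or]
        constructor
        · rintro ⟨rfl, rfl⟩
          exact ⟨_, Finset.mem_powerset.2 (Finset.filter_subset _ _), ⟨rfl, rfl⟩, rfl⟩
        · rintro ⟨B, -, ⟨rfl, rfl⟩, rfl⟩
          exact ⟨rfl, rfl⟩
    rw [hset]
    refine MeasurableSet.union ?_ (Finset.measurableSet_biUnion _ fun B hB =>
      MeasurableSet.inter ?_ (hrun.measurableSet_draw ht B))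
    · exact measurableSet_of_state hx hst hfb
        (fun x b' S' => Continue k lam C r S' x b' t ∧ b' = b ∧ S' = S₀)
        fun x x' b' S' hb h => by rw [continue_congr S' hb h]
    · refine measurableSet_of_state hx hst hfb
        (fun x b' S' => ¬ Continue k lam C r S' x b' t ∧ t + 1 = b ∧ B.image x = S₀)
        fun x x' b' S' hb h => ?_
      rw [continue_congr S' hb h, Finset.image_congr (g := x') fun s hs => ?_]
      have := Finset.mem_Icc.1 (Finset.mem_powerset.1 hB hs)
      exact h s this.1 this.2

/-- A property of the state and of the candidates known after step `t` is an event of the past. -/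
theorem measurableSet_past (hrun : IsRun P k lam C r q f ξsq T ℱ x η α fb S z) [Nonempty A]
    {t : ℕ} (ht : t < T) (p : (ℕ → A) → ℕ → Finset A → Prop)
    (hp : ∀ x x' b S, b ≤ t → (∀ s, 1 ≤ s → s ≤ t + 1 → x s = x' s) → (p x b S ↔ p x' b S)) :
    MeasurableSet[ℱ t] {ω | p (fun s => x s ω) (fb t ω) (S t ω)} :=
  measurableSet_of_state (fun _ h1 h2 a => hrun.measurableSet_x ht h1 h2 le_rfl a)
    (hrun.measurableSet_state t ht.le) (hrun.fb_le t ht.le) p hp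

/-- Likewise for a property which only depends on the state. -/
theorem measurableSet_past_state (hrun : IsRun P k lam C r q f ξsq T ℱ x η α fb S z) [Nonempty A]
    {t : ℕ} (ht : t ≤ T) (p : (ℕ → A) → ℕ → Finset A → Prop)
    (hp : ∀ x x' b S, b ≤ t → (∀ s, 1 ≤ s → s ≤ t → x s = x' s) → (p x b S ↔ p x' b S)) :
    MeasurableSet[ℱ t] {ω | p (fun s => x s ω) (fb t ω) (S t ω)} := by
  refine measurableSet_of_state (n := t) (fun s h1 h2 a => ?_)
    (hrun.measurableSet_state t ht) (hrun.fb_le t ht) p hp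
  exact hrun.measurableSet_x (n := s - 1) (by omega) h1 (by omega) (by omega) a

open Classical in
/-- The conditional probability of a large residual after a resparsification. -/
theorem measureReal_not_residualLE_le [IsProbabilityMeasure P]
    (hrun : IsRun P k lam C r q f ξsq T ℱ x η α fb S z) [Nonempty A] {R : Matrix A A ℝ}
    {c ε : ℝ} {t : ℕ} (ht : t < T) {D : Set Ω} (hD : MeasurableSet[ℱ t] D)
    (hDC : ∀ ω ∈ D, ¬ Continue k lam C r (S t ω) (fun s => x s ω) (fb t ω) t)
    (hDε : ∀ ω ∈ D, (∑ B ∈ (Finset.Icc 1 (t + 1)).powerset,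
      if ¬ ResidualLE R lam c (fun s => x s ω) (t + 1) (B.image fun s => x s ω)
        then subsetProb (Finset.Icc 1 (t + 1))
          (inclProb k lam (q t) (S t ω) (fun s => x s ω) (fb t ω)) B else 0) ≤ ε) :
    P.real (D ∩ {ω | ¬ ResidualLE R lam c (fun s => x s ω) (fb (t + 1) ω) (S (t + 1) ω)})
      ≤ ε * P.real D := by
  set F : Finset ℕ → Set Ω := fun B =>
    {ω | ((Finset.Icc 1 (t + 1)).filter fun s => z (t + 1) s ω = true) = B} with hF
  set G : Finset ℕ → Set Ω := fun B =>
    {ω | ¬ ResidualLE R lam c (fun s => x s ω) (t + 1) (B.image fun s => x s ω)} with hG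
  set I := (Finset.Icc 1 (t + 1)).powerset with hI
  have hFm : ∀ B, MeasurableSet (F B) := fun B => ℱ.le _ _ (hrun.measurableSet_draw ht B)
  -- The candidates up to step t + 1 are already known, so whether a subset of draws is bad is an
  -- event of the past; only the subset itself is random.
  have hGm : ∀ B ∈ I, MeasurableSet[ℱ t] (G B) := fun B hB => by
    refine hrun.measurableSet_past ht
      (fun x b S => ¬ ResidualLE R lam c x (t + 1) (B.image x)) fun x x' b S hb h => ?_
    rw [Finset.image_congr (g := x') fun s hs => ?_, residualLE_congr _ h]
    have := Finset.mem_Icc.1 (Finset.mem_powerset.1 hB hs)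
    exact h s this.1 this.2
  have hDm : MeasurableSet D := ℱ.le _ _ hD
  have hint : ∀ B, Integrable (condExp (ℱ t) P ((F B).indicator fun _ => (1 : ℝ))) P :=
    fun B => integrable_condExp
  have hsub : D ∩ {ω | ¬ ResidualLE R lam c (fun s => x s ω) (fb (t + 1) ω) (S (t + 1) ω)}
      ⊆ ⋃ B ∈ I, (D ∩ G B) ∩ F B := by
    rintro ω ⟨hωD, hω⟩
    obtain ⟨h1, h2⟩ := hrun.resparsify_step t ht ω (hDC ω hωD)
    rw [Set.mem_ofPred_eq, h1, h2] at hω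
    simp only [Set.mem_iUnion]
    exact ⟨_, Finset.mem_powerset.2 (Finset.filter_subset _ _), ⟨hωD, hω⟩, rfl⟩
  have hterm : ∀ B ∈ I, P.real ((D ∩ G B) ∩ F B)
      = ∫ ω in D, (G B).indicator (condExp (ℱ t) P ((F B).indicator fun _ => (1 : ℝ))) ω ∂P := by
    intro B hB
    rw [setIntegral_indicator (ℱ.le _ _ (hGm B hB)),
      setIntegral_condExp (ℱ.le t) ((integrable_const (1 : ℝ)).indicator (hFm B))
        (hD.inter (hGm B hB)), setIntegral_indicator (hFm B)]
    simp
  calc P.real (D ∩ {ω | ¬ ResidualLE R lam c (fun s => x s ω) (fb (t + 1) ω) (S (t + 1) ω)})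
      ≤ P.real (⋃ B ∈ I, (D ∩ G B) ∩ F B) := measureReal_mono hsub (measure_ne_top _ _)
    _ ≤ ∑ B ∈ I, P.real ((D ∩ G B) ∩ F B) := measureReal_biUnion_finset_le _ _
    _ = ∑ B ∈ I, ∫ ω in D,
          (G B).indicator (condExp (ℱ t) P ((F B).indicator fun _ => (1 : ℝ))) ω ∂P :=
        Finset.sum_congr rfl hterm
    _ = ∫ ω in D, ∑ B ∈ I,
          (G B).indicator (condExp (ℱ t) P ((F B).indicator fun _ => (1 : ℝ))) ω ∂P := by
        rw [integral_finsetSum]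
        exact fun B hB => ((hint B).indicator (ℱ.le _ _ (hGm B hB))).integrableOn
    _ ≤ ∫ _ in D, ε ∂P := by
        refine setIntegral_mono_on_ae ?_ (integrable_const ε).integrableOn hDm ?_
        · exact integrable_finsetSum _ fun B hB =>
            ((hint B).indicator (ℱ.le _ _ (hGm B hB))).integrableOn
        · have hz : ∀ᵐ ω ∂P, ∀ B ∈ I,
              ¬ Continue k lam C r (S t ω) (fun s => x s ω) (fb t ω) t →
                condExp (ℱ t) P ((F B).indicator fun _ => (1 : ℝ)) ω
                  = subsetProb (Finset.Icc 1 (t + 1))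
                    (inclProb k lam (q t) (S t ω) (fun s => x s ω) (fb t ω)) B := by
            rw [Filter.eventually_all_finset]
            exact fun B hB => hrun.z_law t ht B (Finset.mem_powerset.1 hB)
          filter_upwards [hz] with ω hω hωD
          refine le_trans (Finset.sum_le_sum fun B hB => ?_) (hDε ω hωD)
          rw [Set.indicator_apply]
          simp only [hG, Set.mem_ofPred_eq]
          rw [hω B hB (hDC ω hωD)]
    _ = ε * P.real D := by
        rw [setIntegral_const, smul_eq_mul, mul_comm]

end IsRun

/-! ### Summability of the potential increments. -/

section Numerics

/-- A discrete form of comparing u^(-1-s) with the derivative of -u^(-s)/s, so that the sum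
telescopes. -/
theorem rpow_neg_one_add_le {s : ℝ} (hs : 0 < s) {n : ℕ} (hn : 1 ≤ n) :
    ((n + 1 : ℕ) : ℝ) ^ (-(1 + s))
      ≤ 1 / s * ((n : ℝ) ^ (-s) - ((n + 1 : ℕ) : ℝ) ^ (-s)) := by
  have hn0 : (0 : ℝ) < n := Nat.cast_pos.2 hn
  push_cast
  have hm : (0 : ℝ) < n + 1 := by positivity
  set y : ℝ := n / (n + 1) with hy
  have hy0 : 0 < y := by positivity
  have hny : (n : ℝ) = y * (n + 1) := by rw [hy]; field_simp
  have h1 : (n : ℝ) ^ (-s) = y ^ (-s) * ((n : ℝ) + 1) ^ (-s) := by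
    conv_lhs => rw [hny]
    exact Real.mul_rpow hy0.le hm.le
  have h2 : 1 + s * (1 - y) ≤ y ^ (-s) := by
    rw [Real.rpow_def_of_pos hy0]
    have := Real.log_le_sub_one_of_pos hy0
    have := Real.add_one_le_exp (Real.log y * -s)
    nlinarith
  have h3 : ((n : ℝ) + 1) ^ (-(1 + s)) = (1 - y) * ((n : ℝ) + 1) ^ (-s) := by
    rw [neg_add, Real.rpow_add hm, Real.rpow_neg_one, hy]
    congr 1
    field_simp
    ring
  rw [h1, h3]
  have h4 : 0 ≤ ((n : ℝ) + 1) ^ (-s) := by positivity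
  rw [div_mul_eq_mul_div, one_mul, le_div_iff₀ hs]
  nlinarith

theorem sum_rpow_neg_le {s : ℝ} (hs : 0 < s) (n : ℕ) :
    ∑ t ∈ Finset.Icc 1 n, (t : ℝ) ^ (-(1 + s)) ≤ 1 + 1 / s := by
  have h : ∀ n : ℕ, ∑ t ∈ Finset.Icc 1 (n + 1), (t : ℝ) ^ (-(1 + s))
      ≤ 1 + 1 / s - 1 / s * ((n + 1 : ℕ) : ℝ) ^ (-s) := by
    intro n
    induction n with
    | zero => simp
    | succ n ih =>
      rw [Finset.sum_Icc_succ_top (by omega)]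
      have := rpow_neg_one_add_le hs (n := n + 1) (by omega)
      linarith
  rcases n with _ | n
  · simp
    positivity
  · refine (h n).trans (sub_le_self _ ?_)
    positivity

/-- The weight of the states with a moderate residual in the potential. -/
noncomputable def weight (t : ℕ) : ℝ := 2 * ((t : ℝ) + 1) * (4 * (t : ℝ)) ^ (-(42 / 25) : ℝ)

/-- The increment of the potential. -/
noncomputable def increment (t : ℕ) : ℝ :=
  ((t : ℝ) + 1) * (4 * (t : ℝ)) ^ (-(9 / 4) : ℝ)
    + weight t * (((t : ℝ) + 1) * (4 * (t : ℝ)) ^ (-(7 / 5) : ℝ))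

theorem weight_nonneg (t : ℕ) : 0 ≤ weight t := by
  unfold weight
  positivity

/-- Ensures that a moderate dictionary kept through a step does not raise the potential. The start
at 1 matters: `weight 0` is 0, since a negative real power of 0 is 0. -/
theorem weight_antitone {t : ℕ} (ht : 1 ≤ t) : weight (t + 1) ≤ weight t := by
  have h : ∀ t : ℕ, 1 ≤ t →
      weight t = 1 / 2 * (1 + 1 / (t : ℝ)) * (4 * (t : ℝ)) ^ (-(17 / 25) : ℝ) := by
    intro t ht
    have ht0 : (0 : ℝ) < t := Nat.cast_pos.2 ht
    unfold weight
    rw [show (-(42 / 25) : ℝ) = -(17 / 25) + -1 by norm_num, Real.rpow_add (by positivity),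
      Real.rpow_neg_one]
    field_simp
    ring
  have ht0 : (0 : ℝ) < t := Nat.cast_pos.2 ht
  rw [h t ht, h (t + 1) (by omega)]
  have h1 : (4 * ((t + 1 : ℕ) : ℝ)) ^ (-(17 / 25) : ℝ) ≤ (4 * (t : ℝ)) ^ (-(17 / 25) : ℝ) :=
    Real.rpow_le_rpow_of_nonpos (by positivity) (by push_cast; linarith) (by norm_num)
  have h2 : 1 / ((t + 1 : ℕ) : ℝ) ≤ 1 / (t : ℝ) :=
    one_div_le_one_div_of_le ht0 (by push_cast; linarith)
  gcongr

theorem increment_le {t : ℕ} (ht : 1 ≤ t) :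
    increment t ≤ 1 / 20 * ((t : ℝ) ^ (-(1 + 1 / 4) : ℝ) + (t : ℝ) ^ (-(1 + 1) : ℝ))
      + 1 / 32 * ((t : ℝ) ^ (-(1 + 2 / 25) : ℝ) + 3 * (t : ℝ) ^ (-(1 + 1) : ℝ)) := by
  have ht0 : (0 : ℝ) < t := Nat.cast_pos.2 ht
  have ht1 : (1 : ℝ) ≤ t := Nat.one_le_cast.2 ht
  have hmono : ∀ a : ℝ, a ≤ -(1 + 1) → (t : ℝ) ^ a ≤ (t : ℝ) ^ (-(1 + 1) : ℝ) := fun a ha =>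
    Real.rpow_le_rpow_of_exponent_le ht1 ha
  have e1 : ((t : ℝ) + 1) * (4 * (t : ℝ)) ^ (-(9 / 4) : ℝ)
      = (4 : ℝ) ^ (-(9 / 4) : ℝ) * ((t : ℝ) ^ (-(1 + 1 / 4) : ℝ) + (t : ℝ) ^ (-(9 / 4) : ℝ)) := by
    rw [Real.mul_rpow (by norm_num) ht0.le,
      show (-(1 + 1 / 4) : ℝ) = -(9 / 4) + 1 by norm_num, Real.rpow_add ht0, Real.rpow_one]
    ring
  have e2 : weight t * (((t : ℝ) + 1) * (4 * (t : ℝ)) ^ (-(7 / 5) : ℝ))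
      = 2 * (4 : ℝ) ^ (-(77 / 25) : ℝ) * ((t : ℝ) ^ (-(1 + 2 / 25) : ℝ)
        + 2 * (t : ℝ) ^ (-(52 / 25) : ℝ) + (t : ℝ) ^ (-(77 / 25) : ℝ)) := by
    have h1 : (4 * (t : ℝ)) ^ (-(42 / 25) : ℝ) * (4 * (t : ℝ)) ^ (-(7 / 5) : ℝ)
        = (4 : ℝ) ^ (-(77 / 25) : ℝ) * (t : ℝ) ^ (-(77 / 25) : ℝ) := by
      rw [← Real.rpow_add (by positivity), ← Real.mul_rpow (by norm_num) ht0.le]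
      norm_num
    have h2 : (t : ℝ) ^ (-(52 / 25) : ℝ) = (t : ℝ) ^ (-(77 / 25) : ℝ) * t := by
      rw [show (-(52 / 25) : ℝ) = -(77 / 25) + 1 by norm_num, Real.rpow_add ht0, Real.rpow_one]
    have h3 : (t : ℝ) ^ (-(1 + 2 / 25) : ℝ) = (t : ℝ) ^ (-(77 / 25) : ℝ) * t * t := by
      rw [← h2, show (-(1 + 2 / 25) : ℝ) = -(52 / 25) + 1 by norm_num, Real.rpow_add ht0,
        Real.rpow_one]
    unfold weight
    rw [h2, h3]
    calc _ = 2 * ((t : ℝ) + 1) ^ 2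
          * ((4 * (t : ℝ)) ^ (-(42 / 25) : ℝ) * (4 * (t : ℝ)) ^ (-(7 / 5) : ℝ)) := by ring
      _ = _ := by rw [h1]; ring
  have h4 : (4 : ℝ) ^ (-(9 / 4) : ℝ) ≤ 1 / 20 := by
    rw [Real.rpow_neg (by norm_num), one_div]
    refine inv_anti₀ (by norm_num) ?_
    have : ((4 : ℝ) ^ (9 / 4 : ℝ)) ^ (4 : ℕ) = 4 ^ 9 := by
      rw [← Real.rpow_natCast, ← Real.rpow_mul (by norm_num)]
      norm_num
    refine le_of_pow_le_pow_left₀ (n := 4) (by norm_num) (by positivity) ?_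
    rw [this]
    norm_num
  have h5 : (4 : ℝ) ^ (-(77 / 25) : ℝ) ≤ 1 / 64 := by
    calc (4 : ℝ) ^ (-(77 / 25) : ℝ) ≤ (4 : ℝ) ^ (-3 : ℝ) :=
          Real.rpow_le_rpow_of_exponent_le (by norm_num) (by norm_num)
      _ = 1 / 64 := by
          rw [Real.rpow_neg (by norm_num)]
          norm_num
  unfold increment
  rw [e1, e2]
  have h6 := hmono (-(9 / 4)) (by norm_num)
  have h7 := hmono (-(52 / 25)) (by norm_num)
  have h8 := hmono (-(77 / 25)) (by norm_num)
  refine add_le_add ?_ ?_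
  · gcongr
  · have : 2 * (4 : ℝ) ^ (-(77 / 25) : ℝ) ≤ 1 / 32 := by linarith
    refine mul_le_mul this (by linarith) (by positivity) (by norm_num)

theorem sum_increment_le_one (n : ℕ) : ∑ t ∈ Finset.Icc 1 n, increment t ≤ 1 := by
  have h1 := sum_rpow_neg_le (s := 1 / 4) (by norm_num) n
  have h2 := sum_rpow_neg_le (s := 1) (by norm_num) n
  have h3 := sum_rpow_neg_le (s := 2 / 25) (by norm_num) n
  calc ∑ t ∈ Finset.Icc 1 n, increment t
      ≤ ∑ t ∈ Finset.Icc 1 n, (1 / 20 * ((t : ℝ) ^ (-(1 + 1 / 4) : ℝ) + (t : ℝ) ^ (-(1 + 1) : ℝ))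
        + 1 / 32 * ((t : ℝ) ^ (-(1 + 2 / 25) : ℝ) + 3 * (t : ℝ) ^ (-(1 + 1) : ℝ))) :=
        Finset.sum_le_sum fun t ht => increment_le (Finset.mem_Icc.1 ht).1
    _ ≤ 1 := by
        rw [Finset.sum_add_distrib, ← Finset.mul_sum, ← Finset.mul_sum, Finset.sum_add_distrib,
          Finset.sum_add_distrib, ← Finset.mul_sum]
        -- The three series are bounded by 5, 2 and 27/2, for a total of 7/20 + 39/64 < 1.
        norm_num at h1 h2 h3 ⊢
        linarith

/-- The failure probability of a resparsification in terms of `δ` and `t`. -/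
theorem exp_neg_mul_le {δ q : ℝ} (hδ0 : 0 < δ) (hδ1 : δ < 1) {t : ℕ} (ht : 1 ≤ t)
    (hq : 8 * Real.log (4 * (t : ℝ) / δ) ≤ q) {h e : ℝ} (he : e = 8 * h) (he1 : 1 ≤ e) :
    Real.exp (-(q * h)) ≤ δ * (4 * (t : ℝ)) ^ (-e) := by
  have ht0 : (0 : ℝ) < t := Nat.cast_pos.2 ht
  have hu : 0 < 4 * (t : ℝ) / δ := by positivity
  have hh : 0 ≤ h := by linarith
  calc Real.exp (-(q * h)) ≤ Real.exp (Real.log (4 * (t : ℝ) / δ) * -e) := by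
        refine Real.exp_le_exp.2 ?_
        rw [he]
        nlinarith [mul_le_mul_of_nonneg_right hq hh]
    _ = (4 * (t : ℝ) / δ) ^ (-e) := (Real.rpow_def_of_pos hu _).symm
    _ = δ ^ e * (4 * (t : ℝ)) ^ (-e) := by
        rw [Real.div_rpow (by positivity) hδ0.le, Real.rpow_neg hδ0.le, div_inv_eq_mul, mul_comm]
    _ ≤ δ * (4 * (t : ℝ)) ^ (-e) := by
        gcongr
        calc δ ^ e ≤ δ ^ (1 : ℝ) := Real.rpow_le_rpow_of_exponent_ge hδ0 hδ1.le he1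
          _ = δ := Real.rpow_one δ

end Numerics

/-! ### The levels of the residual: sharp, moderate, failed. -/

section Levels

variable {A : Type*} [Fintype A] {Ω : Type*} (R : Matrix A A ℝ) (lam : ℝ) (x : ℕ → Ω → A)
  (fb : ℕ → Ω → ℕ) (S : ℕ → Ω → Finset A)

/-- The residual covariance after step `t` is at most `c * lam`. -/
def Accurate (c : ℝ) (t : ℕ) : Set Ω :=
  {ω | ResidualLE R lam c (fun s => x s ω) (fb t ω) (S t ω)}

/-- Some dictionary up to step `t` has a large residual. -/
def Failed (t : ℕ) : Set Ω := {ω | ∃ u ≤ t, ω ∉ Accurate R lam x fb S (4 / 3) u}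

/-- The dictionary in use after step `t` is empty or has a small residual. -/
def Sharp (t : ℕ) : Set Ω := {ω | S t ω = ∅ ∨ ω ∈ Accurate R lam x fb S (3 / 5) t}

/-- No dictionary has failed, and the current one is sharp. -/
def Small (t : ℕ) : Set Ω := (Failed R lam x fb S t)ᶜ ∩ Sharp R lam x fb S t

/-- No dictionary has failed, and the current one is not sharp. -/
def Moderate (t : ℕ) : Set Ω := (Failed R lam x fb S t)ᶜ ∩ (Sharp R lam x fb S t)ᶜ

/-- The current batch ends with the candidate selected at step `t + 1`. -/
def BatchEnd [DecidableEq A] (k : Matrix A A ℝ) (C : ℝ) (r : ℕ) (t : ℕ) : Set Ω :=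
  {ω | ¬ Continue k lam C r (S t ω) (fun s => x s ω) (fb t ω) t}

end Levels

/-! ### Transitions between the levels and the potential argument. -/

namespace IsRun

variable {A : Type*} [Fintype A] [DecidableEq A] {Ω : Type*} [mΩ : MeasurableSpace Ω]
  {P : Measure Ω} {k : Matrix A A ℝ} {lam C : ℝ} {r : ℕ} {q : ℕ → ℝ} {f : A → ℝ} {ξsq : NNReal}
  {T : ℕ} {ℱ : Filtration ℕ mΩ} {x : ℕ → Ω → A} {η : ℕ → Ω → ℝ} {α : ℕ → Ω → ℝ}
  {fb : ℕ → Ω → ℕ} {S : ℕ → Ω → Finset A} {z : ℕ → ℕ → Ω → Bool} {R : Matrix A A ℝ}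

theorem measurableSet_accurate (hrun : IsRun P k lam C r q f ξsq T ℱ x η α fb S z) [Nonempty A]
    (c : ℝ) {t : ℕ} (ht : t ≤ T) : MeasurableSet[ℱ t] (Accurate R lam x fb S c t) :=
  hrun.measurableSet_past_state ht (fun x b S => ResidualLE R lam c x b S)
    fun _ _ _ S hb h => residualLE_congr S fun s h1 h2 => h s h1 (h2.trans hb)

theorem measurableSet_failed (hrun : IsRun P k lam C r q f ξsq T ℱ x η α fb S z) [Nonempty A]
    {t : ℕ} (ht : t ≤ T) : MeasurableSet[ℱ t] (Failed R lam x fb S t) := by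
  have : Failed R lam x fb S t = ⋃ u ∈ Finset.range (t + 1), (Accurate R lam x fb S (4 / 3) u)ᶜ := by
    ext ω
    simp [Failed]
  rw [this]
  refine Finset.measurableSet_biUnion _ fun u hu => MeasurableSet.compl ?_
  have hut : u ≤ t := Nat.lt_succ_iff.1 (Finset.mem_range.1 hu)
  exact ℱ.mono hut _ (hrun.measurableSet_accurate _ (hut.trans ht))

theorem measurableSet_sharp (hrun : IsRun P k lam C r q f ξsq T ℱ x η α fb S z) [Nonempty A]
    {t : ℕ} (ht : t ≤ T) : MeasurableSet[ℱ t] (Sharp R lam x fb S t) :=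
  hrun.measurableSet_past_state ht (fun x b S => S = ∅ ∨ ResidualLE R lam (3 / 5) x b S)
    fun _ _ b S hb h => by rw [residualLE_congr S fun s h1 h2 => h s h1 (h2.trans hb)]

theorem measurableSet_batchEnd (hrun : IsRun P k lam C r q f ξsq T ℱ x η α fb S z) [Nonempty A]
    {t : ℕ} (ht : t < T) : MeasurableSet[ℱ t] (BatchEnd lam x fb S k C r t) :=
  hrun.measurableSet_past ht (fun x b S => ¬ Continue k lam C r S x b t)
    fun _ _ b S hb h => by rw [continue_congr S hb h]

theorem accurate_succ_iff (hrun : IsRun P k lam C r q f ξsq T ℱ x η α fb S z) {t : ℕ}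
    (ht : t < T) {ω : Ω} (h : ω ∉ BatchEnd lam x fb S k C r t) (c : ℝ) :
    ω ∈ Accurate R lam x fb S c (t + 1) ↔ ω ∈ Accurate R lam x fb S c t := by
  obtain ⟨h1, h2⟩ := hrun.batch_step t ht ω (not_not.1 h)
  simp only [Accurate, Set.mem_ofPred_eq, h1, h2]

theorem sharp_succ_iff (hrun : IsRun P k lam C r q f ξsq T ℱ x η α fb S z) {t : ℕ}
    (ht : t < T) {ω : Ω} (h : ω ∉ BatchEnd lam x fb S k C r t) :
    ω ∈ Sharp R lam x fb S (t + 1) ↔ ω ∈ Sharp R lam x fb S t := by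
  have h2 := (hrun.batch_step t ht ω (not_not.1 h)).2
  simp only [Sharp, Set.mem_ofPred_eq, hrun.accurate_succ_iff ht h, h2]

/-- Within a batch neither the dictionary nor the design used by the residual changes, so a first
failure occurs only at a resparsification. -/
theorem failed_succ_subset (hrun : IsRun P k lam C r q f ξsq T ℱ x η α fb S z) {t : ℕ}
    (ht : t < T) {ω : Ω} (hω : ω ∈ Failed R lam x fb S (t + 1)) (h0 : ω ∉ Failed R lam x fb S t) :
    ω ∈ BatchEnd lam x fb S k C r t ∧ ω ∉ Accurate R lam x fb S (4 / 3) (t + 1) := by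
  obtain ⟨u, hu, huω⟩ := hω
  have hut : u = t + 1 := by
    by_contra hne
    exact h0 ⟨u, by omega, huω⟩
  subst hut
  refine ⟨?_, huω⟩
  by_contra h
  exact h0 ⟨t, le_rfl, fun h' => huω ((hrun.accurate_succ_iff ht h _).2 h')⟩

theorem failed_mono {t : ℕ} : Failed R lam x fb S t ⊆ Failed R lam x fb S (t + 1) :=
  fun _ ⟨u, hu, h⟩ => ⟨u, hu.trans (Nat.le_succ t), h⟩

variable [IsProbabilityMeasure P]

/-- Transition probabilities between the levels of the residual. -/
theorem measureReal_transition_le (hrun : IsRun P k lam C r q f ξsq T ℱ x η α fb S z)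
    [Nonempty A] (hk : k = Rᵀ * R) (hlam : 0 < lam) {c c' β h : ℝ} (hc : 0 < c) (hc' : 0 ≤ c')
    (hβ : 0 < β) (hh : 0 < h) (hcond : h * (1 + (1 + 1 / β) * c' + (1 + β) * c) ≤ c) {t : ℕ}
    (ht : t < T) (hq : 0 < q t) {D : Set Ω} (hD : MeasurableSet[ℱ t] D)
    (hDC : D ⊆ BatchEnd lam x fb S k C r t)
    (hold : ∀ ω ∈ D, S t ω = ∅ ∨ ω ∈ Accurate R lam x fb S c' t) :
    P.real (D ∩ (Accurate R lam x fb S c (t + 1))ᶜ)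
      ≤ ((t : ℝ) + 1) * Real.exp (-(q t * h)) * P.real D := by
  refine hrun.measureReal_not_residualLE_le ht hD hDC fun ω hω => ?_
  refine (sum_not_residualLE_le hk hlam hc hc' hβ hh hq hcond
    ((hrun.fb_le t ht.le ω).trans (Nat.le_succ t)) (hold ω hω)).trans_eq ?_
  push_cast
  ring

/-- The evolution of the probabilities of the levels. -/
theorem measureReal_levels_succ_le (hrun : IsRun P k lam C r q f ξsq T ℱ x η α fb S z)
    [Nonempty A] (hk : k = Rᵀ * R) (hlam : 0 < lam) {t : ℕ} (ht : t < T) (hq : 0 < q t) :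
    P.real (Failed R lam x fb S (t + 1)) ≤ P.real (Failed R lam x fb S t)
        + ((t : ℝ) + 1) * Real.exp (-(q t * (9 / 32)))
        + ((t : ℝ) + 1) * Real.exp (-(q t * (21 / 100)))
          * P.real (Moderate R lam x fb S t ∩ BatchEnd lam x fb S k C r t) ∧
      P.real (Moderate R lam x fb S (t + 1))
        ≤ ((t : ℝ) + 1) * Real.exp (-(q t * (7 / 40)))
        + ((t : ℝ) + 1) * Real.exp (-(q t * (1 / 8)))
          * P.real (Moderate R lam x fb S t ∩ BatchEnd lam x fb S k C r t)
        + P.real (Moderate R lam x fb S t \ BatchEnd lam x fb S k C r t) := by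
  set N := BatchEnd lam x fb S k C r t with hN
  set D₀ := Small R lam x fb S t ∩ N with hD₀
  set D₁ := Moderate R lam x fb S t ∩ N with hD₁
  have hNm := hrun.measurableSet_batchEnd ht
  have hFm := hrun.measurableSet_failed (R := R) ht.le
  have hSm := hrun.measurableSet_sharp (R := R) ht.le
  have hm₀ : MeasurableSet[ℱ t] D₀ := (hFm.compl.inter hSm).inter hNm
  have hm₁ : MeasurableSet[ℱ t] D₁ := (hFm.compl.inter hSm.compl).inter hNm
  have hold₀ : ∀ ω ∈ D₀, S t ω = ∅ ∨ ω ∈ Accurate R lam x fb S (3 / 5) t := fun ω hω => hω.1.2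
  have hold₁ : ∀ ω ∈ D₁, S t ω = ∅ ∨ ω ∈ Accurate R lam x fb S (4 / 3) t := fun ω hω =>
    Or.inr (by_contra fun h => hω.1.1 ⟨t, le_rfl, h⟩)
  -- In the four transitions β is close to √(c'/c), its best value, and h lies slightly below the
  -- resulting bound. With q = 8 log(4t/δ), the values of h give powers 9/4, 7/5, 42/25 and 1 of 4t.
  have h02 := hrun.measureReal_transition_le hk hlam (c := 4 / 3) (c' := 3 / 5) (β := 2 / 3)
    (h := 9 / 32) (by norm_num) (by norm_num) (by norm_num) (by norm_num) (by norm_num) ht hq hm₀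
    Set.inter_subset_right hold₀
  have h01 := hrun.measureReal_transition_le hk hlam (c := 3 / 5) (c' := 3 / 5) (β := 1)
    (h := 7 / 40) (by norm_num) (by norm_num) (by norm_num) (by norm_num) (by norm_num) ht hq hm₀
    Set.inter_subset_right hold₀
  have h12 := hrun.measureReal_transition_le hk hlam (c := 4 / 3) (c' := 4 / 3) (β := 1)
    (h := 21 / 100) (by norm_num) (by norm_num) (by norm_num) (by norm_num) (by norm_num) ht hq hm₁
    Set.inter_subset_right hold₁
  have h11 := hrun.measureReal_transition_le hk hlam (c := 3 / 5) (c' := 4 / 3) (β := 3 / 2)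
    (h := 1 / 8) (by norm_num) (by norm_num) (by norm_num) (by norm_num) (by norm_num) ht hq hm₁
    Set.inter_subset_right hold₁
  have hle : ∀ a : ℝ, ((t : ℝ) + 1) * Real.exp (-(q t * a)) * P.real D₀
      ≤ ((t : ℝ) + 1) * Real.exp (-(q t * a)) := fun a =>
    mul_le_of_le_one_right (by positivity) measureReal_le_one
  have hcase : ∀ ω, ω ∉ Failed R lam x fb S t → ω ∈ N → ω ∈ D₀ ∨ ω ∈ D₁ := fun ω h1 h2 => by
    by_cases h3 : ω ∈ Sharp R lam x fb S t
    · exact Or.inl ⟨⟨h1, h3⟩, h2⟩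
    · exact Or.inr ⟨⟨h1, h3⟩, h2⟩
  constructor
  · have hsub : Failed R lam x fb S (t + 1) ⊆ (Failed R lam x fb S t
        ∪ (D₀ ∩ (Accurate R lam x fb S (4 / 3) (t + 1))ᶜ))
        ∪ (D₁ ∩ (Accurate R lam x fb S (4 / 3) (t + 1))ᶜ) := by
      intro ω hω
      by_cases h0 : ω ∈ Failed R lam x fb S t
      · exact Or.inl (Or.inl h0)
      · obtain ⟨h1, h2⟩ := hrun.failed_succ_subset ht hω h0
        rcases hcase ω h0 h1 with h | h
        · exact Or.inl (Or.inr ⟨h, h2⟩)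
        · exact Or.inr ⟨h, h2⟩
    have h1 := (measureReal_mono hsub (measure_ne_top P _)).trans ((measureReal_union_le _ _).trans
      (add_le_add_left (measureReal_union_le _ _) _))
    linarith [hle (9 / 32)]
  · have hsub : Moderate R lam x fb S (t + 1) ⊆ ((D₀ ∩ (Accurate R lam x fb S (3 / 5) (t + 1))ᶜ)
        ∪ (D₁ ∩ (Accurate R lam x fb S (3 / 5) (t + 1))ᶜ)) ∪ (Moderate R lam x fb S t \ N) := by
      intro ω hω
      have h0 : ω ∉ Failed R lam x fb S t := fun h => hω.1 (failed_mono h)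
      by_cases h1 : ω ∈ N
      · have h2 : ω ∉ Accurate R lam x fb S (3 / 5) (t + 1) := fun h => hω.2 (Or.inr h)
        rcases hcase ω h0 h1 with h | h
        · exact Or.inl (Or.inl ⟨h, h2⟩)
        · exact Or.inl (Or.inr ⟨h, h2⟩)
      · exact Or.inr ⟨⟨h0, fun h => hω.2 ((hrun.sharp_succ_iff ht h1).2 h)⟩, h1⟩
    have h1 := (measureReal_mono hsub (measure_ne_top P _)).trans ((measureReal_union_le _ _).trans
      (add_le_add_left (measureReal_union_le _ _) _))
    linarith [hle (7 / 40)]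

theorem accurate_zero (hrun : IsRun P k lam C r q f ξsq T ℱ x η α fb S z) (hlam : 0 < lam)
    {c : ℝ} (hc : 0 ≤ c) (ω : Ω) : ω ∈ Accurate R lam x fb S c 0 := by
  intro v _
  have h0 : energy R (fun s => x s ω) (fb 0 ω) v = 0 := by simp [hrun.fb_zero, energy]
  have := dotProduct_self_nonneg' v
  rw [h0]
  positivity

theorem failed_zero (hrun : IsRun P k lam C r q f ξsq T ℱ x η α fb S z) (hlam : 0 < lam) :
    Failed R lam x fb S 0 = ∅ := by
  ext ω
  simp only [Failed, Set.mem_ofPred_eq, Set.mem_empty_iff_false, iff_false, not_exists, not_and,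
    not_not]
  intro u hu
  rw [Nat.le_zero.1 hu]
  exact hrun.accurate_zero hlam (by norm_num) ω

theorem approxVar_empty (x : ℕ → A) (t : ℕ) (a : A) (hk : k = Rᵀ * R) :
    approxVar k lam ∅ x t a = (1 / lam) * (feat R a ⬝ᵥ feat R a) := by
  have : k a a = feat R a ⬝ᵥ feat R a := by rw [hk]; rfl
  simp [approxVar, dotProduct, this]

/-- After the first step, the dictionary is empty or consists of the first candidate, and it has a
small residual almost surely. -/
theorem measureReal_levels_one (hrun : IsRun P k lam C r q f ξsq T ℱ x η α fb S z) [Nonempty A]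
    (hk : k = Rᵀ * R) (hlam : 0 < lam) (hT : 0 < T) (hq : 1 ≤ q 0) :
    P.real (Failed R lam x fb S 1) = 0 ∧ Moderate R lam x fb S 1 = ∅ := by
  constructor
  · refine le_antisymm ?_ measureReal_nonneg
    have hsub : Failed R lam x fb S (0 + 1) ⊆ BatchEnd lam x fb S k C r 0
        ∩ (Accurate R lam x fb S (4 / 3) (0 + 1))ᶜ := fun ω hω =>
      hrun.failed_succ_subset hT hω (by simp [hrun.failed_zero hlam])
    refine (measureReal_mono hsub (measure_ne_top P _)).trans ?_
    have h := hrun.measureReal_not_residualLE_le (R := R) (c := 4 / 3) (ε := 0) hT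
      (hrun.measurableSet_batchEnd hT) (fun ω hω => hω) fun ω hω => ?_
    · rw [zero_mul] at h
      exact h
    · refine Finset.sum_nonpos fun B hB => ?_
      split_ifs with hbad
      · exact le_rfl
      · have hB' : B ⊆ {1} := by simpa using hB
        simp only [subsetProb, zero_add, Finset.Icc_self, Finset.prod_singleton, hrun.S_zero,
          inclProb, approxVar_empty _ _ _ hk]
        unfold ResidualLE at hbad
        push Not at hbad
        obtain ⟨v, hv, hvc⟩ := hbad
        simp only [energy, zero_add, Finset.Icc_self, Finset.sum_singleton] at hvc
        -- If x₁ is left out, a large residual forces |φ(x₁)|² ≥ λ by Cauchy–Schwarz; its inclusion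
        -- probability is then 1 and this draw has probability 0. If x₁ is retained, the residual is
        -- 0.
        rcases Finset.subset_singleton_iff.1 hB' with rfl | rfl
        · simp only [Finset.notMem_empty, if_false]
          rw [min_eq_left, sub_self]
          have hcs : (feat R (x 1 ω) ⬝ᵥ v) ^ 2
              ≤ (feat R (x 1 ω) ⬝ᵥ feat R (x 1 ω)) * (v ⬝ᵥ v) := by
            simp only [dotProduct, ← sq]
            exact Finset.sum_mul_sq_le_sq_mul_sq _ _ _
          have hv0 := dotProduct_self_nonneg' v
          have h1 : lam ≤ feat R (x 1 ω) ⬝ᵥ feat R (x 1 ω) := by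
            by_contra! hlt
            have h2 := mul_le_mul_of_nonneg_right hlt.le hv0
            have h3 : 0 ≤ lam * (v ⬝ᵥ v) := by positivity
            linarith
          have h2 : 1 ≤ 1 / lam * (feat R (x 1 ω) ⬝ᵥ feat R (x 1 ω)) := by
            rw [div_mul_eq_mul_div, one_mul, le_div_iff₀ hlam, one_mul]
            exact h1
          nlinarith
        · have h0 := hv (x 1 ω) (by simp)
          have hv0 := dotProduct_self_nonneg' v
          rw [h0] at hvc
          have h3 : 0 ≤ lam * (v ⬝ᵥ v) := by positivity
          linarith
  · rw [Set.eq_empty_iff_forall_notMem]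
    rintro ω ⟨-, hω⟩
    refine hω ?_
    by_cases hN : ω ∈ BatchEnd lam x fb S k C r 0
    · obtain ⟨h1, h2⟩ := hrun.resparsify_step 0 hT ω hN
      by_cases hz : z 1 1 ω = true
      · refine Or.inr fun v hv => ?_
        have hS : x 1 ω ∈ S 1 ω := by
          rw [zero_add] at h2
          rw [h2]
          exact Finset.mem_image.2 ⟨1, by simp [hz], rfl⟩
        have h0 : energy R (fun s => x s ω) (fb 1 ω) v = 0 := by
          rw [zero_add] at h1
          simp [energy, h1, hv _ hS]
        have := dotProduct_self_nonneg' v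
        rw [h0]
        positivity
      · refine Or.inl ?_
        rw [zero_add] at h2
        rw [h2]
        simp [Finset.filter_singleton, hz]
    · exact Or.inl ((hrun.batch_step 0 hT ω (not_not.1 hN)).2.trans (hrun.S_zero ω))

/-- The potential of the run grows by at most `δ * increment t`. -/
theorem potential_succ_le (hrun : IsRun P k lam C r q f ξsq T ℱ x η α fb S z) [Nonempty A]
    (hk : k = Rᵀ * R) (hlam : 0 < lam) {δ : ℝ} (hδ0 : 0 < δ) (hδ1 : δ < 1) {t : ℕ} (ht1 : 1 ≤ t)
    (ht : t < T) (hq1 : 1 ≤ q t) (hq : 8 * Real.log (4 * (t : ℝ) / δ) ≤ q t) :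
    P.real (Failed R lam x fb S (t + 1)) + weight (t + 1) * P.real (Moderate R lam x fb S (t + 1))
      ≤ P.real (Failed R lam x fb S t) + weight t * P.real (Moderate R lam x fb S t)
        + δ * increment t := by
  obtain ⟨h1, h2⟩ := hrun.measureReal_levels_succ_le hk hlam ht (by linarith)
  set N := BatchEnd lam x fb S k C r t
  have hNm : MeasurableSet N := ℱ.le _ _ (hrun.measurableSet_batchEnd ht)
  have hsplit := measureReal_inter_add_sdiff (μ := P) (s := Moderate R lam x fb S t) hNm
  have ht0 : (0 : ℝ) < t := Nat.cast_pos.2 ht1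
  have ht1' : (1 : ℝ) ≤ t := Nat.one_le_cast.2 ht1
  have e02 := exp_neg_mul_le hδ0 hδ1 ht1 hq (h := 9 / 32) (e := 9 / 4) (by norm_num) (by norm_num)
  have e01 := exp_neg_mul_le hδ0 hδ1 ht1 hq (h := 7 / 40) (e := 7 / 5) (by norm_num) (by norm_num)
  have e12 := exp_neg_mul_le hδ0 hδ1 ht1 hq (h := 21 / 100) (e := 42 / 25) (by norm_num)
    (by norm_num)
  have e11 := exp_neg_mul_le hδ0 hδ1 ht1 hq (h := 1 / 8) (e := 1) (by norm_num) (by norm_num)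
  have hw := weight_antitone ht1
  have hw0 := weight_nonneg (t + 1)
  have hw0' := weight_nonneg t
  set pN := P.real (Moderate R lam x fb S t ∩ N)
  set pC := P.real (Moderate R lam x fb S t \ N)
  have hpN : 0 ≤ pN := measureReal_nonneg
  have hpC : 0 ≤ pC := measureReal_nonneg
  -- Half of the weight of a redrawn moderate state pays for its possible failure; the other half
  -- pays for its remaining moderate, by `f11`. This is the origin of the factor 2 in `weight`.
  have f12 : ((t : ℝ) + 1) * Real.exp (-(q t * (21 / 100))) ≤ weight t / 2 := by
    unfold weight
    have h3 : 0 ≤ (4 * (t : ℝ)) ^ (-(42 / 25) : ℝ) := by positivity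
    have h4 : Real.exp (-(q t * (21 / 100))) ≤ (4 * (t : ℝ)) ^ (-(42 / 25) : ℝ) := by nlinarith
    have := mul_le_mul_of_nonneg_left h4 (by positivity : 0 ≤ (t : ℝ) + 1)
    linarith
  have f11 : ((t : ℝ) + 1) * Real.exp (-(q t * (1 / 8))) ≤ 1 / 2 := by
    rw [Real.rpow_neg_one] at e11
    have h3 : 0 ≤ (4 * (t : ℝ))⁻¹ := by positivity
    have h4 : Real.exp (-(q t * (1 / 8))) ≤ (4 * (t : ℝ))⁻¹ := by nlinarith
    calc ((t : ℝ) + 1) * Real.exp (-(q t * (1 / 8))) ≤ ((t : ℝ) + 1) * (4 * (t : ℝ))⁻¹ := by gcongr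
      _ ≤ 1 / 2 := by
        rw [← div_eq_mul_inv, div_le_iff₀ (by positivity)]
        linarith
  have f02 := mul_le_mul_of_nonneg_left e02 (by positivity : 0 ≤ (t : ℝ) + 1)
  have f01 := mul_le_mul_of_nonneg_left e01 (by positivity : 0 ≤ (t : ℝ) + 1)
  set E01 := ((t : ℝ) + 1) * Real.exp (-(q t * (7 / 40)))
  have g2 : weight (t + 1) * P.real (Moderate R lam x fb S (t + 1))
      ≤ weight t * (E01 + 1 / 2 * pN + pC) := by
    refine mul_le_mul hw (h2.trans ?_) measureReal_nonneg hw0'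
    gcongr
  have g3 := mul_le_mul_of_nonneg_left f01 hw0'
  have g4 := mul_le_mul_of_nonneg_right f12 hpN
  rw [← hsplit]
  unfold increment
  linarith

theorem measureReal_failed_le (hrun : IsRun P k lam C r q f ξsq T ℱ x η α fb S z) [Nonempty A]
    (hk : k = Rᵀ * R) (hlam : 0 < lam) {δ : ℝ} (hδ0 : 0 < δ) (hδ1 : δ < 1)
    (hq1 : ∀ t, 1 ≤ q t) (hq : ∀ t : ℕ, 1 ≤ t → 8 * Real.log (4 * (t : ℝ) / δ) ≤ q t) :
    P.real (Failed R lam x fb S T) ≤ δ := by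
  -- The potential is followed from step 1, where it vanishes, since the bound on q involving δ
  -- starts at t = 1.
  have key : ∀ n : ℕ, n + 1 ≤ T →
      P.real (Failed R lam x fb S (n + 1)) + weight (n + 1) * P.real (Moderate R lam x fb S (n + 1))
        ≤ δ * ∑ t ∈ Finset.Icc 1 n, increment t := by
    intro n
    induction n with
    | zero =>
      intro hn
      obtain ⟨h1, h2⟩ := hrun.measureReal_levels_one hk hlam hn (hq1 0)
      simp [h1, h2]
    | succ n ih =>
      intro hn
      have := hrun.potential_succ_le hk hlam hδ0 hδ1 (t := n + 1) (by omega) (by omega) (hq1 _)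
        (hq _ (by omega))
      rw [Finset.sum_Icc_succ_top (by omega), mul_add]
      linarith [ih (by omega)]
  rcases T with _ | n
  · rw [hrun.failed_zero hlam]
    simpa using hδ0.le
  · have h1 := key n le_rfl
    have h2 := mul_nonneg (weight_nonneg (n + 1))
      (measureReal_nonneg (μ := P) (s := Moderate R lam x fb S (n + 1)))
    have h3 := mul_le_mul_of_nonneg_left (sum_increment_le_one n) hδ0.le
    linarith

end IsRun

end BBKB

theorem mainTheorem3 {A : Type*} [Fintype A] [DecidableEq A]
    {Ω : Type*} [mΩ : MeasurableSpace Ω] (P : MeasureTheory.Measure Ω)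
    [MeasureTheory.IsProbabilityMeasure P]
    (k : Matrix A A ℝ) (hk : k.PosSemidef)
    (δ C lam : ℝ) (hδ0 : 0 < δ) (hδ1 : δ < 1) (hC : 1 ≤ C) (hlam : 1 ≤ lam)
    (r : ℕ) (hr : r = 1 ∨ r = 2)
    (q : ℕ → ℝ) (hq1 : ∀ t, 1 ≤ q t) (hq : ∀ t : ℕ, 1 ≤ t → 8 * Real.log (4 * (t : ℝ) / δ) ≤ q t)
    (f : A → ℝ) (ξsq : NNReal) (T : ℕ)
    (ℱ : MeasureTheory.Filtration ℕ mΩ) (x : ℕ → Ω → A) (η : ℕ → Ω → ℝ) (α : ℕ → Ω → ℝ)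
    (fb : ℕ → Ω → ℕ) (S : ℕ → Ω → Finset A) (z : ℕ → ℕ → Ω → Bool)
    (hrun : BBKB.IsRun P k lam C r q f ξsq T ℱ x η α fb S z) :
    1 - δ ≤ P.real {ω | ∀ t ≤ T, ∀ a : A,
      BBKB.exactVar k lam (fun s => x s ω) (fb t ω) a / 3
          ≤ BBKB.approxVar k lam (S t ω) (fun s => x s ω) (fb t ω) a ∧
        BBKB.approxVar k lam (S t ω) (fun s => x s ω) (fb t ω) a
          ≤ 3 * BBKB.exactVar k lam (fun s => x s ω) (fb t ω) a} := by
  obtain ⟨R, hk⟩ := BBKB.exists_transpose_mul_self hk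
  have hlam0 : 0 < lam := by linarith
  obtain ⟨ω₀⟩ : Nonempty Ω := MeasureTheory.nonempty_of_isProbabilityMeasure P
  -- The value at index 0 is not a candidate of the run, but it shows that the set of candidates is
  -- nonempty.
  have : Nonempty A := ⟨x 0 ω₀⟩
  have hm : MeasurableSet (BBKB.Failed R lam x fb S T) :=
    ℱ.le _ _ (hrun.measurableSet_failed le_rfl)
  have h1 := hrun.measureReal_failed_le hk hlam0 hδ0 hδ1 hq1 hq
  have h2 := MeasureTheory.probReal_compl_eq_one_sub (μ := P) hm
  refine le_trans (by linarith) (MeasureTheory.measureReal_mono (fun ω hω t ht a => ?_)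
    (MeasureTheory.measure_ne_top P _))
  exact BBKB.approxVar_accurate hk hlam0 (by_contra fun h => hω ⟨t, ht, h⟩) a
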